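/- Let $H$ and $K$ be complex Hilbert spaces, and equip the space $B(H,K)$ of bounded linear operators from $H$ to $K$ with the triple product $\{a,b,c\}=\frac12(ab^*c+cb^*a)$. A tripotent is an element $e\in B(H,K)$ with $\{e,e,e\}=e$. For tripotents $u,e\in B(H,K)$ write - $u\le_2 e$ if $\{e,e,u\}=u$ (that is, $u$ lies in the Peirce-$2$ subspace of $e$); - $u\le_h e$ if $u=\{e,u,e\}$; - $u\le_{hc} e$ if $\alpha u\le_h e$ for some $\alpha\in\mathbb C$ with $|\alpha|=1$; - $u\le_n e$ if $u=\{e,e,u\}$ and $\{u,u,e\}$ is a tripotent. Let $\le_{h,t}$, $\le_{hc,t}$ and $\le_{n,t}$ be the transitive hulls of $\le_h$, $\le_{hc}$ and $\le_n$ on the set of tripotents of $B(H,K)$. For each of these relations, indexed by $\ast$, write $u\sim_\ast e$ if $u\le_\ast e$ and $e\le_\ast u$. Then the following hold. (a) The relations $\le_{n,t}$ and $\le_{hc,t}$ on the tripotents of $B(H,K)$ coincide; in particular, the relations $\sim_2$ and $\sim_{hc,t}$ coincide. (b) If $H$ or $K$ is finite-dimensional, then the relations $\le_2$, $\le_{n,t}$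 and $\le_{hc,t}$ on the tripotents of $B(H,K)$ all coincide. (c) If $u,v\in B(H,K)$ are tripotents with $u\sim_{h,t}v$, then there are tripotents $v_1,v_2,v_3\in B(H,K)$ such that $u\sim_h v_3\sim_h v_2\sim_h v_1\sim_h v$. -/

import Mathlib

noncomputable section

namespace TripotentOrder

universe u₁ u₂

variable {H : Type u₁} {K : Type u₂}
  [NormedAddCommGroup H] [InnerProductSpace ℂ H] [CompleteSpace H]
  [NormedAddCommGroup K] [InnerProductSpace ℂ K] [CompleteSpace K]

/-- The triple product `{a, b, c} = (a b* c + c b* a) / 2` of `B(H, K)`. -/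
def tripleProd (a b c : H →L[ℂ] K) : H →L[ℂ] K :=
  (1 / 2 : ℂ) • (a ∘L (ContinuousLinearMap.adjoint b ∘L c)
    + c ∘L (ContinuousLinearMap.adjoint b ∘L a))

/-- `e` is a tripotent: `{e, e, e} = e`. -/
def IsTripotent (e : H →L[ℂ] K) : Prop := tripleProd e e e = e

variable (H K) in
/-- The type of all tripotents of `B(H, K)`. -/
abbrev Tripotent : Type (max u₁ u₂) := {e : H →L[ℂ] K // IsTripotent e}

/-- The Peirce-2 subspace of `e`: the eigenspace of `L(e, e) : x ↦ {e, e, x}` at the eigenvalue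
`1`. -/
def peirceTwo (e : H →L[ℂ] K) : Set (H →L[ℂ] K) := {x | tripleProd e e x = x}

/-- `u ≤_2 e`: `u` lies in the Peirce-2 subspace of `e`. -/
def LeTwo (u e : H →L[ℂ] K) : Prop := u ∈ peirceTwo e

/-- `u ≤_h e`: `u = {e, u, e}`. -/
def LeH (u e : H →L[ℂ] K) : Prop := u = tripleProd e u e

/-- `u ≤_{hc} e`: `α u ≤_h e` for some complex unit `α`. -/
def LeHC (u e : H →L[ℂ] K) : Prop := ∃ α : ℂ, ‖α‖ = 1 ∧ LeH (α • u) e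

/-- `u ≤_n e`: `u = {e, e, u}` and `{u, u, e}` is a tripotent. -/
def LeN (u e : H →L[ℂ] K) : Prop := u = tripleProd e e u ∧ IsTripotent (tripleProd u u e)

/-- The transitive hull, on the set of tripotents of `B(H, K)`, of the relation `R`. -/
def TransHull (R : (H →L[ℂ] K) → (H →L[ℂ] K) → Prop) : Tripotent H K → Tripotent H K → Prop :=
  Relation.TransGen fun u e => R u e

/-- `u ∼_2 e`. -/
def SimTwo (u e : Tripotent H K) : Prop := LeTwo u.1 e.1 ∧ LeTwo e.1 u.1

/-- `u ∼_h e`. -/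
def SimH (u e : Tripotent H K) : Prop := LeH u.1 e.1 ∧ LeH e.1 u.1

/-- `u ≤_{h,t} e`. -/
def LeHT (u e : Tripotent H K) : Prop := TransHull LeH u e

/-- `u ∼_{h,t} e`. -/
def SimHT (u e : Tripotent H K) : Prop := LeHT u e ∧ LeHT e u

/-- `u ≤_{hc,t} e`. -/
def LeHCT (u e : Tripotent H K) : Prop := TransHull LeHC u e

/-- `u ∼_{hc,t} e`. -/
def SimHCT (u e : Tripotent H K) : Prop := LeHCT u e ∧ LeHCT e u

/-- `u ≤_{n,t} e`. -/
def LeNT (u e : Tripotent H K) : Prop := TransHull LeN u e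

end TripotentOrder

end

/-! A tripotent `e` is a partial isometry. Its initial space `M` identifies the Peirce-2 space of
`e` with `B(M)`, where `e` becomes the identity (`exists_corner`), and all the relations carry over.
The tripotents `∼_2`-equivalent to `e` become the unitaries of `M`. If `A` is unitary and `s` is a
symmetry (a self-adjoint unitary), then `A s ∼_h A`, so a factorization of a unitary into symmetries
is a chain of `∼_h` steps ending at the identity.

The core is `exists_four_symmetries`: a unitary is a product of four symmetries if `M` is
infinite-dimensional or its determinant is `±1`. It is first made diagonal: by eigenvectors in
finite dimension, and otherwise over countably many copies of one space, obtained by grouping cyclic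
subspaces. A diagonal operator splits into two diagonal ones whose entries are mutually inverse in
pairs, and each of these is a product of two symmetries.

For (a), a scalar factor makes the determinant one, so every unitary is `≤_{hc,t} 1`; moreover `W
≤_n 1` forces `W W* = W* W`, so that `W` is unitary on its range and reaches `1` through the
projection `W W*`. For (b), a partial isometry in finite dimension extends to a unitary. For (c),
`≤_h` preserves the squared determinant of unitaries, so a `∼_{h,t}`-equivalent tripotent satisfies
the determinant condition. -/

noncomputable section

namespace TripotentOrder

/-! ### Splitting a sequence in a group into two sequences of paired inverses. -/

section Alternating

variable {G : Type*} [Group G]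

/-- The products `w 0`, `w 0 * w 1`, `w 2 * w 0 * w 1`, `w 2 * w 0 * w 1 * w 3`, …, in which new
factors are attached alternately on the right and on the left. -/
def altProd (w : ℕ → G) : ℕ → G
  | 0 => w 0
  | k + 1 => if Even k then altProd w k * w (k + 1) else w (k + 1) * altProd w k

/-- A sequence in a group is a product of two sequences each of which consists of mutually inverse
neighbours. The sequence may be restricted to an initial segment of `ℕ`, if the alternating product
of all its entries is an involution. -/
theorem exists_alternating_factorization (w : ℕ → G) (p : ℕ → Prop)
    (hp : ∀ k, p (k + 1) → p k)
    (hend : ∀ k, p k → ¬ p (k + 1) → altProd w k * altProd w k = 1) :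
    ∃ (σ τ : {k // p k} → {k // p k}) (a b : {k // p k} → G),
      Function.Involutive σ ∧ Function.Involutive τ ∧
      (∀ k, a k * a (σ k) = 1) ∧ (∀ k, b k * b (τ k) = 1) ∧ ∀ k, a k * b k = w k := by
  classical
  have hpred : ∀ k, p k → p (k - 1) := by
    rintro (_ | k) h
    · exact h
    · exact hp k h
  set c := altProd w with hc
  -- `σ` swaps 0↔1, 2↔3, …, while `τ` swaps 1↔2, 3↔4, … and fixes 0 because `0 - 1 = 0`. The last
  -- index, if there is one, loses its partner and is fixed by one of them; `hend` covers the case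
  -- where its entry is the full alternating product.
  let σ : ℕ → ℕ := fun k => if Even k then (if p (k + 1) then k + 1 else k) else k - 1
  let τ : ℕ → ℕ := fun k => if Even k then k - 1 else (if p (k + 1) then k + 1 else k)
  have hσ : ∀ k, p k → p (σ k) := by
    intro k h
    simp only [σ]
    split_ifs <;> first | assumption | exact hpred k h
  have hτ : ∀ k, p k → p (τ k) := by
    intro k h
    simp only [τ]
    split_ifs <;> first | assumption | exact hpred k h
  -- The products telescope: `c k = w k * c (k - 1)` for even `k > 0` and `c k = c (k - 1) * w k`
  -- for odd `k`, so `a k * b k = w k`.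
  let a : ℕ → G := fun k => if Even k then c k else (c (k - 1))⁻¹
  let b : ℕ → G := fun k => if k = 0 then 1 else if Even k then (c (k - 1))⁻¹ else c k
  refine ⟨fun k => ⟨σ k, hσ k k.2⟩, fun k => ⟨τ k, hτ k k.2⟩, fun k => a k, fun k => b k,
    ?_, ?_, ?_, ?_, ?_⟩
  · rintro ⟨k, hk⟩
    apply Subtype.ext
    by_cases h : Even k
    · by_cases h1 : p (k + 1)
      · simp [σ, h, h1, Nat.even_add_one]
      · simp [σ, h, h1]
    · obtain ⟨k, rfl⟩ : ∃ j, k = j + 1 := Nat.exists_eq_succ_of_ne_zero (by rintro rfl; simp at h)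
      rw [Nat.even_add_one, not_not] at h
      simp [σ, h, hk, Nat.even_add_one]
  · rintro ⟨k, hk⟩
    apply Subtype.ext
    by_cases h : Even k
    · rcases k with _ | k
      · simp [τ]
      · have h' := h
        rw [Nat.even_add_one] at h
        simp [τ, h, h', hk]
    · by_cases h1 : p (k + 1)
      · simp [τ, h, h1, Nat.even_add_one]
      · simp [τ, h, h1]
  · rintro ⟨k, hk⟩
    by_cases h : Even k
    · by_cases h1 : p (k + 1)
      · simp [σ, a, h, h1, Nat.even_add_one]
      · simp [σ, a, h, h1, hend k hk h1]
    · obtain ⟨k, rfl⟩ : ∃ j, k = j + 1 := Nat.exists_eq_succ_of_ne_zero (by rintro rfl; simp at h)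
      rw [Nat.even_add_one, not_not] at h
      simp [σ, a, h, Nat.even_add_one]
  · rintro ⟨k, hk⟩
    by_cases h : Even k
    · rcases k with _ | k
      · simp [τ, b]
      · have h' := h
        rw [Nat.even_add_one] at h
        have h0 : k ≠ 0 := by rintro rfl; simp at h
        simp [τ, b, h, h', h0]
    · have h0 : k ≠ 0 := by rintro rfl; simp at h
      by_cases h1 : p (k + 1)
      · simp [τ, b, h, h0, h1, Nat.even_add_one]
      · simp [τ, b, h, h0, h1, hend k hk h1]
  · rintro ⟨k, hk⟩
    rcases k with _ | k
    · simp [a, b, hc, altProd]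
    · by_cases h : Even k
      · simp [a, b, h, Nat.even_add_one, hc, altProd]
      · simp [a, b, h, Nat.even_add_one, hc, altProd]

end Alternating

/-! ### Monomial and diagonal unitaries on Hilbert sums. -/

section HilbertSum

variable {M N : Type*} [NormedAddCommGroup M] [InnerProductSpace ℂ M] [CompleteSpace M]
  [NormedAddCommGroup N] [InnerProductSpace ℂ N] [CompleteSpace N]
  {ι : Type*} {V : ι → N →ₗᵢ[ℂ] M}

theorem IsHilbertSum.dense_iSup_range (hV : IsHilbertSum ℂ (fun _ : ι => N) V) :
    (⨆ i, LinearMap.range (V i).toLinearMap).topologicalClosure = ⊤ := by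
  rw [← hV.OrthogonalFamily.range_linearIsometry, LinearMap.range_eq_top]
  exact hV.surjective_isometry

omit [CompleteSpace M] in
theorem isometryEquiv_mul_apply (S T : M ≃ₗᵢ[ℂ] M) (x : M) : (S * T) x = S (T x) := rfl

/-- Isometries that agree on all summands of a Hilbert sum are equal. -/
theorem IsHilbertSum.linearIsometryEquiv_ext (hV : IsHilbertSum ℂ (fun _ : ι => N) V)
    {S T : M ≃ₗᵢ[ℂ] M} (h : ∀ i n, S (V i n) = T (V i n)) : S = T := by
  have hcl : IsClosed {x | S x = T x} := isClosed_eq S.continuous T.continuous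
  have hle : (⨆ i, LinearMap.range (V i).toLinearMap) ≤
      LinearMap.eqLocus (S : M →ₗ[ℂ] M) (T : M →ₗ[ℂ] M) := by
    refine iSup_le fun i => ?_
    rintro _ ⟨n, rfl⟩
    exact h i n
  ext x
  have hx : x ∈ (⨆ i, LinearMap.range (V i).toLinearMap).topologicalClosure := by
    rw [IsHilbertSum.dense_iSup_range hV]; trivial
  exact closure_minimal (fun y hy => hle hy) hcl hx

/-- The monomial unitary operator on a Hilbert sum of copies of one space that is given by a
permutation of the summands and a unitary operator on each of them. -/
theorem IsHilbertSum.exists_monomial (hV : IsHilbertSum ℂ (fun _ : ι => N) V)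
    (σ : Equiv.Perm ι) (U : ι → N ≃ₗᵢ[ℂ] N) :
    ∃ T : M ≃ₗᵢ[ℂ] M, ∀ i n, T (V i n) = V (σ i) (U i n) := by
  classical
  have hV' : IsHilbertSum ℂ (fun _ : ι => N)
      (fun i => (V (σ i)).comp (U i).toLinearIsometry) := by
    refine IsHilbertSum.mk ?_ ?_
    · intro i j hij x y
      exact hV.OrthogonalFamily (σ.injective.ne hij) (U i x) (U j y)
    · rw [← IsHilbertSum.dense_iSup_range hV]
      refine Submodule.topologicalClosure_mono (iSup_le fun i => ?_)
      refine le_trans ?_ (le_iSup _ (σ.symm i))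
      rintro _ ⟨n, rfl⟩
      exact ⟨(U (σ.symm i)).symm n, by simp⟩
  refine ⟨hV.linearIsometryEquiv.trans hV'.linearIsometryEquiv.symm, fun i n => ?_⟩
  have h1 : hV.linearIsometryEquiv (V i n) = lp.single 2 i n := by
    rw [← hV.linearIsometryEquiv_symm_apply_single, LinearIsometryEquiv.apply_symm_apply]
  rw [LinearIsometryEquiv.trans_apply, h1, hV'.linearIsometryEquiv_symm_apply_single]
  rfl

/-- On a swapped pair of summands this is diag(a, a⁻¹) = [[0, a], [a⁻¹, 0]] · [[0, 1], [1, 0]]. On a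
fixed summand `a i` is already an involution. -/
theorem IsHilbertSum.exists_two_symmetries (hV : IsHilbertSum ℂ (fun _ : ι => N) V)
    {σ : ι → ι} (hσ : Function.Involutive σ) {a : ι → N ≃ₗᵢ[ℂ] N}
    (ha : ∀ i, a i * a (σ i) = 1) :
    ∃ s t : M ≃ₗᵢ[ℂ] M, s * s = 1 ∧ t * t = 1 ∧ ∀ i n, (s * t) (V i n) = V i (a i n) := by
  obtain ⟨t, ht⟩ := IsHilbertSum.exists_monomial hV hσ.toPerm (fun _ => 1)
  obtain ⟨s, hs⟩ := IsHilbertSum.exists_monomial hV hσ.toPerm (fun i => a (σ i))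
  simp only [Function.Involutive.coe_toPerm, LinearIsometryEquiv.coe_one, id_eq] at ht hs
  refine ⟨s, t, IsHilbertSum.linearIsometryEquiv_ext hV fun i n => ?_,
    IsHilbertSum.linearIsometryEquiv_ext hV fun i n => ?_, fun i n => ?_⟩
  · rw [isometryEquiv_mul_apply, hs, hs, hσ i, ← isometryEquiv_mul_apply, ha]
    rfl
  · rw [isometryEquiv_mul_apply, ht, ht, hσ i]
    rfl
  · rw [isometryEquiv_mul_apply, ht, hs, hσ i]

/-- A diagonal unitary operator on a Hilbert sum indexed by an initial segment of `ℕ` is a product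
of four symmetries, if in the finite case the alternating product of its entries is one. -/
theorem IsHilbertSum.exists_four_symmetries {p : ℕ → Prop} {V : {k // p k} → N →ₗᵢ[ℂ] M}
    (hV : IsHilbertSum ℂ (fun _ : {k // p k} => N) V) (hp : ∀ k, p (k + 1) → p k)
    (w : ℕ → N ≃ₗᵢ[ℂ] N)
    (hend : ∀ k, p k → ¬ p (k + 1) → altProd w k * altProd w k = 1)
    (W : M ≃ₗᵢ[ℂ] M) (hW : ∀ i n, W (V i n) = V i (w i n)) :
    ∃ s₁ s₂ s₃ s₄ : M ≃ₗᵢ[ℂ] M, s₁ * s₁ = 1 ∧ s₂ * s₂ = 1 ∧ s₃ * s₃ = 1 ∧ s₄ * s₄ = 1 ∧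
      W = s₁ * s₂ * s₃ * s₄ := by
  obtain ⟨σ, τ, a, b, hσ, hτ, ha, hb, hab⟩ := exists_alternating_factorization w p hp hend
  obtain ⟨s₁, s₂, h₁, h₂, h12⟩ := IsHilbertSum.exists_two_symmetries hV hσ ha
  obtain ⟨s₃, s₄, h₃, h₄, h34⟩ := IsHilbertSum.exists_two_symmetries hV hτ hb
  refine ⟨s₁, s₂, s₃, s₄, h₁, h₂, h₃, h₄,
    IsHilbertSum.linearIsometryEquiv_ext hV fun i n => ?_⟩
  rw [mul_assoc (s₁ * s₂), isometryEquiv_mul_apply, h34, h12, hW, ← hab,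
    isometryEquiv_mul_apply]

omit [CompleteSpace M] [CompleteSpace N] in
/-- A unitary operator that leaves the range of an isometry invariant, together with its inverse,
restricts to a unitary operator. -/
theorem exists_restriction_of_range_invariant (V : N →ₗᵢ[ℂ] M) (W : M ≃ₗᵢ[ℂ] M)
    (h : ∀ n, W (V n) ∈ LinearMap.range V.toLinearMap)
    (h' : ∀ n, W.symm (V n) ∈ LinearMap.range V.toLinearMap) :
    ∃ w : N ≃ₗᵢ[ℂ] N, ∀ n, W (V n) = V (w n) := by
  choose f hf using h
  choose g hg using h'
  have hf' : ∀ n, V (f n) = W (V n) := hf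
  have hg' : ∀ n, V (g n) = W.symm (V n) := hg
  refine ⟨⟨⟨⟨⟨f, fun x y => V.injective ?_⟩, fun c x => V.injective ?_⟩, g, fun x => V.injective ?_,
    fun x => V.injective ?_⟩, fun x => ?_⟩, fun n => (hf' n).symm⟩
  · simp [hf']
  · simp [hf']
  · simp [hf', hg']
  · simp [hf', hg']
  · change ‖f x‖ = ‖x‖
    rw [← V.norm_map, hf', W.norm_map, V.norm_map]

end HilbertSum

/-! ### Orthogonal cyclic subspaces of a unitary operator. -/

section Cyclic

variable {M : Type*} [NormedAddCommGroup M] [InnerProductSpace ℂ M]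

open scoped InnerProductSpace

theorem commute_zpow_apply {F : M →L[ℂ] M} {W : M ≃ₗᵢ[ℂ] M} (h : ∀ x, F (W x) = W (F x))
    (n : ℤ) (x : M) : F ((W ^ n) x) = (W ^ n) (F x) := by
  have h' : ∀ x, F (W⁻¹ x) = W⁻¹ (F x) := by
    intro x
    apply W.injective
    rw [← h]
    change F (W (W.symm x)) = W (W.symm (F x))
    simp
  induction n generalizing x with
  | zero => rfl
  | succ k ih => rw [zpow_add_one, isometryEquiv_mul_apply, ih, h, isometryEquiv_mul_apply]
  | pred k ih => rw [zpow_sub_one, isometryEquiv_mul_apply, ih, h', isometryEquiv_mul_apply]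

theorem inner_zpow_left (W : M ≃ₗᵢ[ℂ] M) (n : ℤ) (x y : M) :
    ⟪(W ^ n) x, y⟫_ℂ = ⟪x, (W ^ (-n)) y⟫_ℂ := by
  rw [← (W ^ n).inner_map_map x, ← isometryEquiv_mul_apply, ← zpow_add, add_neg_cancel, zpow_zero]
  rfl

theorem zpow_apply_of_apply_eq_smul {W : M ≃ₗᵢ[ℂ] M} {c : ℂ} {x : M} (h : W x = c • x) (n : ℤ) :
    ∃ d : ℂ, (W ^ n) x = d • x := by
  have h' : ∃ d : ℂ, W⁻¹ x = d • x := by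
    by_cases hc : c = 0
    · refine ⟨0, ?_⟩
      have : x = 0 := by
        apply W.injective
        rw [h, hc, zero_smul, map_zero]
      simp [this]
    · refine ⟨c⁻¹, ?_⟩
      apply W.injective
      rw [map_smul, h, smul_smul, inv_mul_cancel₀ hc, one_smul]
      exact W.apply_symm_apply x
  obtain ⟨d', h'⟩ := h'
  induction n with
  | zero => exact ⟨1, (one_smul ℂ x).symm⟩
  | succ k ih =>
    obtain ⟨d, hd⟩ := ih
    exact ⟨c * d, by rw [zpow_add_one, isometryEquiv_mul_apply, h, map_smul, hd, smul_smul]⟩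
  | pred k ih =>
    obtain ⟨d, hd⟩ := ih
    exact ⟨d' * d, by rw [zpow_sub_one, isometryEquiv_mul_apply, h', map_smul, hd, smul_smul]⟩

/-- The cyclic subspaces generated by `x` and `y` are orthogonal. -/
def CyclicOrthogonal (W : M ≃ₗᵢ[ℂ] M) (x y : M) : Prop := ∀ n : ℤ, ⟪(W ^ n) x, y⟫_ℂ = 0

theorem CyclicOrthogonal.inner_zpow_zpow {W : M ≃ₗᵢ[ℂ] M} {x y : M} (h : CyclicOrthogonal W x y)
    (m n : ℤ) : ⟪(W ^ m) x, (W ^ n) y⟫_ℂ = 0 := by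
  rw [← neg_neg n, ← inner_zpow_left, ← isometryEquiv_mul_apply, ← zpow_add]
  exact h _

theorem CyclicOrthogonal.symm {W : M ≃ₗᵢ[ℂ] M} {x y : M} (h : CyclicOrthogonal W x y) :
    CyclicOrthogonal W y x := by
  intro n
  rw [inner_zpow_left, ← inner_conj_symm, h, map_zero]

variable [CompleteSpace M]

/-- Infinitely many points of the spectrum yield infinitely many orthogonal cyclic subspaces. -/
theorem exists_seq_cyclicOrthogonal_of_infinite_spectrum (W : M ≃ₗᵢ[ℂ] M)
    (hinf : (spectrum ℂ (W : M →L[ℂ] M)).Infinite) :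
    ∃ x : ℕ → M, (∀ k, x k ≠ 0) ∧ Pairwise fun j k => CyclicOrthogonal W (x j) (x k) := by
  set T : M →L[ℂ] M := (W : M →L[ℂ] M) with hTdef
  have hT : IsStarNormal T := by
    rw [hTdef, ← Unitary.coe_symm_linearIsometryEquiv_apply]
    infer_instance
  have : Infinite (spectrum ℂ T) := hinf.to_subtype
  obtain ⟨U, hUi, hUo, hUd⟩ := exists_seq_infinite_isOpen_pairwise_disjoint (spectrum ℂ T)
  -- The complement must be nonempty because `Metric.infDist` to the empty set is 0 by convention,
  -- which would make `f k` vanish.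
  have hne : ∀ k, ((U k)ᶜ : Set (spectrum ℂ T)).Nonempty := by
    intro k
    obtain ⟨z, hz⟩ := (hUi (k + 1)).nonempty
    exact ⟨z, fun hz' => Set.disjoint_left.1 (hUd (Nat.succ_ne_self k)) hz hz'⟩
  let f : ℕ → C(spectrum ℂ T, ℂ) := fun k =>
    ⟨fun z => ((Metric.infDist z (U k)ᶜ : ℝ) : ℂ),
      Complex.continuous_ofReal.comp (Metric.continuous_infDist_pt _)⟩
  have hf0 : ∀ k, f k ≠ 0 := by
    intro k h0
    obtain ⟨z, hz⟩ := (hUi k).nonempty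
    have h1 : f k z = 0 := by rw [h0]; rfl
    have h2 : Metric.infDist z (U k)ᶜ = 0 := by
      simpa [f] using h1
    have h3 : z ∈ (U k)ᶜ :=
      ((hUo k).isClosed_compl.mem_iff_infDist_zero (hne k)).2 h2
    exact h3 hz
  have hfmul : ∀ j k, j ≠ k → f k * f j = 0 := by
    intro j k hjk
    ext z
    by_cases hz : z ∈ U k
    · have hz' : z ∈ (U j)ᶜ := fun h => Set.disjoint_left.1 (hUd hjk) h hz
      simp [f, Metric.infDist_zero_of_mem hz']
    · simp [f, Metric.infDist_zero_of_mem (show z ∈ (U k)ᶜ from hz)]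
  have hfstar : ∀ k, star (f k) = f k := by
    intro k
    ext z
    simp [f]
  let Φ : C(spectrum ℂ T, ℂ) →⋆ₐ[ℂ] (M →L[ℂ] M) := cfcHom (R := ℂ) hT
  obtain ⟨z₀, hid, hz₀⟩ : ∃ z₀ : C(spectrum ℂ T, ℂ), Φ z₀ = T ∧ ∀ z, z₀ z = z :=
    ⟨_, cfcHom_id hT, fun _ => rfl⟩
  have hΦ : Function.Injective Φ := cfcHom_injective hT
  have hcomm : ∀ k x, Φ (f k) (W x) = W (Φ (f k) x) := by
    intro k x
    have h1 : Φ (f k) * T = T * Φ (f k) := by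
      have h2 : Φ (f k) * Φ z₀ = Φ z₀ * Φ (f k) := by rw [← map_mul, mul_comm, map_mul]
      rwa [hid] at h2
    exact DFunLike.congr_fun h1 x
  have hex : ∀ k, ∃ y, Φ (f k) y ≠ 0 := by
    intro k
    by_contra! h
    exact hf0 k (hΦ (by rw [map_zero]; ext y; exact h y))
  choose y hy using hex
  -- Each `f k` is supported in `U k`, so the operators `Φ (f k)` have mutually orthogonal ranges;
  -- they commute with `W`, so these ranges are invariant under its powers.
  refine ⟨fun k => Φ (f k) (y k), hy, fun j k hjk n => ?_⟩
  have hadj : ContinuousLinearMap.adjoint (Φ (f k)) = Φ (f k) := by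
    rw [← ContinuousLinearMap.star_eq_adjoint, ← map_star, hfstar]
  have hzero : Φ (f k) (Φ (f j) (y j)) = 0 := by
    have h1 : Φ (f k) * Φ (f j) = 0 := by rw [← map_mul, hfmul j k hjk, map_zero]
    exact DFunLike.congr_fun h1 (y j)
  change ⟪(W ^ n) (Φ (f j) (y j)), Φ (f k) (y k)⟫_ℂ = 0
  rw [← ContinuousLinearMap.adjoint_inner_left, hadj, commute_zpow_apply (hcomm k), hzero,
    map_zero, inner_zero_left]

/-- If the spectrum is finite, the eigenspaces span. -/
theorem iSup_eigenspace_eq_top_of_finite_spectrum (W : M ≃ₗᵢ[ℂ] M)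
    (hfin : (spectrum ℂ (W : M →L[ℂ] M)).Finite) :
    ⨆ c : spectrum ℂ (W : M →L[ℂ] M),
      Module.End.eigenspace ((W : M →L[ℂ] M) : M →ₗ[ℂ] M) (c : ℂ) = ⊤ := by
  classical
  set T : M →L[ℂ] M := (W : M →L[ℂ] M) with hTdef
  have hT : IsStarNormal T := by
    rw [hTdef, ← Unitary.coe_symm_linearIsometryEquiv_apply]
    infer_instance
  have : Finite (spectrum ℂ T) := hfin.to_subtype
  have : Fintype (spectrum ℂ T) := Fintype.ofFinite _
  have : DiscreteTopology (spectrum ℂ T) := inferInstance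
  -- A finite spectrum is discrete, so indicators of points are continuous and give the spectral
  -- projections.
  let e : spectrum ℂ T → C(spectrum ℂ T, ℂ) := fun c =>
    ⟨fun z => if z = c then 1 else 0, continuous_of_discreteTopology⟩
  let Φ : C(spectrum ℂ T, ℂ) →⋆ₐ[ℂ] (M →L[ℂ] M) := cfcHom (R := ℂ) hT
  obtain ⟨z₀, hid, hz₀⟩ : ∃ z₀ : C(spectrum ℂ T, ℂ), Φ z₀ = T ∧ ∀ z, z₀ z = z :=
    ⟨_, cfcHom_id hT, fun _ => rfl⟩
  have hsum : ∑ c, Φ (e c) = 1 := by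
    rw [← map_sum, ← map_one Φ]
    congr 1
    ext z
    simp [e]
  have hmul : ∀ c : spectrum ℂ T, T * Φ (e c) = (c : ℂ) • Φ (e c) := by
    intro c
    suffices h1 : Φ z₀ * Φ (e c) = (c : ℂ) • Φ (e c) by rwa [hid] at h1
    rw [← map_mul, ← map_smul]
    congr 1
    ext z
    by_cases h : z = c <;> simp [e, h, hz₀]
  rw [eq_top_iff]
  intro x _
  have hx : x = ∑ c, Φ (e c) x := by
    conv_lhs => rw [← one_apply_eq_self (F := M →L[ℂ] M) x, ← hsum]
    simp
  rw [hx]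
  refine Submodule.sum_mem _ fun c _ => ?_
  refine Submodule.mem_iSup_of_mem c ?_
  rw [Module.End.mem_eigenspace_iff]
  exact DFunLike.congr_fun (hmul c) x

/-- An infinite-dimensional space contains infinitely many orthogonal cyclic subspaces of a given
unitary operator. -/
theorem exists_seq_cyclicOrthogonal (W : M ≃ₗᵢ[ℂ] M) (hM : ¬ FiniteDimensional ℂ M) :
    ∃ x : ℕ → M, (∀ k, x k ≠ 0) ∧ Pairwise fun j k => CyclicOrthogonal W (x j) (x k) := by
  by_cases hfin : (spectrum ℂ (W : M →L[ℂ] M)).Finite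
  swap
  · exact exists_seq_cyclicOrthogonal_of_infinite_spectrum W hfin
  have htop := iSup_eigenspace_eq_top_of_finite_spectrum W hfin
  have : Finite (spectrum ℂ (W : M →L[ℂ] M)) := hfin.to_subtype
  -- Finitely many eigenspaces span, so one is infinite-dimensional; inside it every cyclic subspace
  -- is a line, and orthonormal vectors suffice.
  obtain ⟨c, hc⟩ : ∃ c : spectrum ℂ (W : M →L[ℂ] M), ¬ FiniteDimensional ℂ
      (Module.End.eigenspace ((W : M →L[ℂ] M) : M →ₗ[ℂ] M) (c : ℂ)) := by
    by_contra! h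
    apply hM
    have h1 := Submodule.finiteDimensional_iSup fun c : spectrum ℂ (W : M →L[ℂ] M) =>
      Module.End.eigenspace ((W : M →L[ℂ] M) : M →ₗ[ℂ] M) (c : ℂ)
    rw [htop] at h1
    exact Module.Finite.of_surjective (⊤ : Submodule ℂ M).subtype
      (fun x => ⟨⟨x, trivial⟩, rfl⟩)
  set E := Module.End.eigenspace ((W : M →L[ℂ] M) : M →ₗ[ℂ] M) (c : ℂ) with hE
  have hEW : ∀ x : E, W x = (c : ℂ) • (x : M) := fun x => Module.End.mem_eigenspace_iff.1 x.2
  have hcl : IsClosed (E : Set M) := by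
    have : (E : Set M) = {x | W x = (c : ℂ) • x} := by
      ext x
      exact Module.End.mem_eigenspace_iff
    rw [this]
    exact isClosed_eq W.continuous (continuous_const_smul _)
  have : CompleteSpace E := hcl.completeSpace_coe
  obtain ⟨s, b, hb⟩ := exists_hilbertBasis ℂ E
  have hs : Infinite s := by
    by_contra h
    rw [not_infinite_iff_finite] at h
    have : Fintype s := Fintype.ofFinite s
    exact hc (b.toOrthonormalBasis.toBasis.finiteDimensional_of_finite)
  let g := Infinite.natEmbedding s
  refine ⟨fun k => (b (g k) : M), fun k => ?_, fun j k hjk n => ?_⟩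
  · simpa using b.orthonormal.ne_zero (g k)
  · obtain ⟨d, hd⟩ := zpow_apply_of_apply_eq_smul (hEW (b (g j))) n
    have h0 := b.orthonormal.2 (g.injective.ne hjk)
    rw [hd, inner_smul_left, ← Submodule.coe_inner, h0, mul_zero]

/-- A maximal family of orthogonal cyclic subspaces is total. -/
theorem exists_total_cyclicOrthogonal (W : M ≃ₗᵢ[ℂ] M) (hM : ¬ FiniteDimensional ℂ M) :
    ∃ X : Set M, X.Infinite ∧ (∀ x ∈ X, x ≠ 0) ∧ X.Pairwise (CyclicOrthogonal W) ∧
      ∀ y, (∀ x ∈ X, ∀ n : ℤ, ⟪(W ^ n) x, y⟫_ℂ = 0) → y = 0 := by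
  -- Zorn's lemma is applied above an infinite family so that the maximal family is infinite too.
  obtain ⟨x, hx0, hx⟩ := exists_seq_cyclicOrthogonal W hM
  let S : Set (Set M) := {X | (∀ x ∈ X, x ≠ 0) ∧ X.Pairwise (CyclicOrthogonal W)}
  obtain ⟨X, hxX, hX⟩ := zorn_subset_nonempty S (by
    intro C hC hch _
    refine ⟨⋃₀ C, ⟨?_, ?_⟩, fun s hs => Set.subset_sUnion_of_mem hs⟩
    · rintro y ⟨s, hs, hy⟩
      exact (hC hs).1 y hy
    · exact (Set.pairwise_sUnion hch.directedOn).2 fun s hs => (hC hs).2) (Set.range x) (by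
    refine ⟨?_, ?_⟩
    · rintro _ ⟨k, rfl⟩
      exact hx0 k
    · rintro _ ⟨j, rfl⟩ _ ⟨k, rfl⟩ hjk
      exact hx (fun h => hjk (by rw [h])))
  have hinj : Function.Injective x := by
    intro j k hjk
    by_contra h
    have h1 := hx h 0
    rw [zpow_zero, hjk] at h1
    exact hx0 k (inner_self_eq_zero.1 h1)
  refine ⟨X, (Set.infinite_range_of_injective hinj).mono hxX, hX.prop.1, hX.prop.2, ?_⟩
  intro y hy
  by_contra hy0
  have : Std.Symm (CyclicOrthogonal W) := ⟨fun _ _ h => h.symm⟩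
  have hins : insert y X ∈ S := by
    refine ⟨?_, ?_⟩
    · rintro z (rfl | hz)
      · exact hy0
      · exact hX.prop.1 z hz
    · refine hX.prop.2.insert_of_symm fun z hz _ => ?_
      exact CyclicOrthogonal.symm (hy z hz)
  have hyX : y ∈ X := hX.le_of_ge hins (Set.subset_insert y X) (Set.mem_insert y X)
  exact hy0 (inner_self_eq_zero.1 (hy y hyX 0))

end Cyclic

/-! ### Unitaries as products of four symmetries. -/

section FourSymmetries

variable {M : Type*} [NormedAddCommGroup M] [InnerProductSpace ℂ M] [CompleteSpace M]

open scoped InnerProductSpace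

omit [CompleteSpace M] in
/-- An orthonormal basis of the cyclic subspaces generated by a set of vectors, in such a way that
each of these subspaces is spanned by countably many basis vectors. -/
theorem exists_orthonormal_cyclic (W : M ≃ₗᵢ[ℂ] M) {X : Set M}
    (hX : X.Pairwise (CyclicOrthogonal W)) :
    ∃ g : X → ℕ → M,
      (∀ x, Submodule.span ℂ (Set.range (g x)) =
        Submodule.span ℂ (Set.range fun n : ℤ => (W ^ n) (x : M))) ∧
      Orthonormal ℂ fun xi : {xi : X × ℕ // g xi.1 xi.2 ≠ 0} => g xi.1.1 xi.1.2 := by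
  -- Gram–Schmidt runs along `ℕ`, so the integer powers are enumerated; dependent vectors yield
  -- zeros, which the index subtype discards.
  let q : X → ℕ → M := fun x i => (W ^ (Equiv.intEquivNat.symm i)) (x : M)
  have hq : ∀ x, Set.range (q x) = Set.range fun n : ℤ => (W ^ n) (x : M) := fun x =>
    Equiv.intEquivNat.symm.surjective.range_comp fun n : ℤ => (W ^ n) (x : M)
  have hspan : ∀ x, Submodule.span ℂ (Set.range (InnerProductSpace.gramSchmidtNormed ℂ (q x))) =
      Submodule.span ℂ (Set.range fun n : ℤ => (W ^ n) (x : M)) := by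
    intro x
    rw [InnerProductSpace.span_gramSchmidtNormed_range, InnerProductSpace.span_gramSchmidt, hq]
  refine ⟨fun x => InnerProductSpace.gramSchmidtNormed ℂ (q x), hspan, ?_, ?_⟩
  · rintro ⟨⟨x, i⟩, hxi⟩
    exact InnerProductSpace.gramSchmidtNormed_unit_length' hxi
  · rintro ⟨⟨x, i⟩, hxi⟩ ⟨⟨y, j⟩, hyj⟩ hne
    by_cases hxy : x = y
    · subst hxy
      have hij : i ≠ j := by
        rintro rfl
        exact hne rfl
      exact (InnerProductSpace.gramSchmidtNormed_orthonormal' (𝕜 := ℂ) (q x)).2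
        (i := ⟨i, hxi⟩) (j := ⟨j, hyj⟩) (fun h => hij (congrArg Subtype.val h))
    · have hort : Submodule.span ℂ (Set.range fun n : ℤ => (W ^ n) (x : M)) ⟂
          Submodule.span ℂ (Set.range fun n : ℤ => (W ^ n) (y : M)) := by
        rw [Submodule.isOrtho_span]
        rintro _ ⟨m, rfl⟩ _ ⟨n, rfl⟩
        exact (hX x.2 y.2 (fun h => hxy (Subtype.ext h))).inner_zpow_zpow m n
      refine Submodule.isOrtho_iff_inner_eq.1 hort _ ?_ _ ?_
      · rw [← hspan]
        exact Submodule.subset_span ⟨i, rfl⟩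
      · rw [← hspan]
        exact Submodule.subset_span ⟨j, rfl⟩

/-- A unitary operator on an infinite-dimensional space is diagonal with respect to a Hilbert sum
of countably many copies of one space. -/
theorem exists_isHilbertSum_diagonal (W : M ≃ₗᵢ[ℂ] M) (hM : ¬ FiniteDimensional ℂ M) :
    ∃ (X : Set M) (V : ℕ → lp (fun _ : X => ℂ) 2 →ₗᵢ[ℂ] M)
      (w : ℕ → lp (fun _ : X => ℂ) 2 ≃ₗᵢ[ℂ] lp (fun _ : X => ℂ) 2),
      OrthogonalFamily ℂ (fun _ => lp (fun _ : X => ℂ) 2) V ∧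
      ⊤ ≤ (⨆ k, LinearMap.range (V k).toLinearMap).topologicalClosure ∧
      ∀ k n, W (V k n) = V k (w k n) := by
  obtain ⟨X, hXinf, hX0, hXo, hXtot⟩ := exists_total_cyclicOrthogonal W hM
  have : Infinite X := hXinf.to_subtype
  -- `X` is cut into countably many blocks, each of the cardinality of `X`.
  obtain ⟨ex⟩ : Nonempty (ℕ × X ≃ X) := by
    rw [← Cardinal.eq, Cardinal.mk_prod, Cardinal.mk_nat, Cardinal.lift_aleph0,
      Cardinal.lift_id', Cardinal.aleph0_mul_eq (Cardinal.aleph0_le_mk X)]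
  obtain ⟨g, hgspan, hgo⟩ := exists_orthonormal_cyclic W hXo
  have hg0 : ∀ x, ∃ i, g x i ≠ 0 := by
    intro x
    by_contra! h
    have h1 : (x : M) ∈ Submodule.span ℂ (Set.range (g x)) := by
      rw [hgspan]
      exact Submodule.subset_span ⟨0, rfl⟩
    have h2 : Submodule.span ℂ (Set.range (g x)) = ⊥ := by
      rw [Submodule.span_eq_bot]
      rintro _ ⟨i, rfl⟩
      exact h i
    rw [h2, Submodule.mem_bot] at h1
    exact hX0 x x.2 h1
  let J : ℕ → Type _ := fun k => {ji : X × ℕ // g (ex (k, ji.1)) ji.2 ≠ 0}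
  -- Each block contributes at least one basis vector per element of `X` and at most countably many.
  -- By Schröder–Bernstein every block is modelled on the same ℓ²(X).
  have hJ : ∀ k, Nonempty (X ≃ J k) := by
    intro k
    choose i hi using hg0
    let f₁ : X ↪ J k := ⟨fun j => ⟨(j, i (ex (k, j))), hi _⟩, fun j j' h =>
      congrArg (fun z : J k => z.1.1) h⟩
    let f₂ : J k ↪ X := (Function.Embedding.subtype _).trans
      ((Equiv.prodComm X ℕ).trans ex).toEmbedding
    exact Function.Embedding.antisymm f₁ f₂
  let eJ : ∀ k, X ≃ J k := fun k => (hJ k).some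
  let v : ℕ → X → M := fun k x => g (ex (k, (eJ k x).1.1)) (eJ k x).1.2
  have hv : ∀ k, Orthonormal ℂ (v k) := by
    intro k
    refine hgo.comp (fun x => ⟨(ex (k, (eJ k x).1.1), (eJ k x).1.2), (eJ k x).2⟩) ?_
    intro x y hxy
    have h1 := congrArg Subtype.val hxy
    simp only [Prod.mk.injEq] at h1
    have h2 := ex.injective h1.1
    simp only [Prod.mk.injEq, true_and] at h2
    exact (eJ k).injective (Subtype.ext (Prod.ext h2 h1.2))
  let D : ℕ → Submodule ℂ M := fun k =>
    ⨆ j : X, Submodule.span ℂ (Set.range fun n : ℤ => (W ^ n) (ex (k, j) : M))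
  have hDspan : ∀ k, Submodule.span ℂ (Set.range (v k)) = D k := by
    intro k
    simp only [D, ← hgspan]
    apply le_antisymm
    · rw [Submodule.span_le]
      rintro _ ⟨x, rfl⟩
      exact Submodule.mem_iSup_of_mem (eJ k x).1.1 (Submodule.subset_span ⟨_, rfl⟩)
    · refine iSup_le fun j => Submodule.span_le.2 ?_
      rintro _ ⟨i, rfl⟩
      by_cases h : g (ex (k, j)) i = 0
      · rw [h]
        exact Submodule.zero_mem _
      · refine Submodule.subset_span ⟨(eJ k).symm ⟨(j, i), h⟩, ?_⟩
        simp [v]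
  let V : ℕ → lp (fun _ : X => ℂ) 2 →ₗᵢ[ℂ] M := fun k => (hv k).orthogonalFamily.linearIsometry
  have hVrange : ∀ k, LinearMap.range (V k).toLinearMap = (D k).topologicalClosure := by
    intro k
    rw [← hDspan]
    refine (OrthogonalFamily.range_linearIsometry _).trans ?_
    congr 1
    simp [← LinearMap.span_singleton_eq_range, ← Submodule.span_iUnion]
  have hDW : ∀ k (m : ℤ) x, x ∈ (D k).topologicalClosure →
      (W ^ m) x ∈ (D k).topologicalClosure := by
    intro k m x hx
    have hmap : D k ≤ (D k).comap ((W ^ m).toLinearEquiv : M →ₗ[ℂ] M) := by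
      refine iSup_le fun j => Submodule.span_le.2 ?_
      rintro _ ⟨n, rfl⟩
      refine Submodule.mem_iSup_of_mem j (Submodule.subset_span ⟨m + n, ?_⟩)
      simp only [zpow_add]
      rfl
    exact map_mem_closure (W ^ m).continuous hx fun y hy => hmap hy
  have hDo : ∀ k l, k ≠ l → D k ⟂ D l := by
    intro k l hkl
    simp only [D, Submodule.isOrtho_iSup_left, Submodule.isOrtho_iSup_right,
      Submodule.isOrtho_span]
    rintro j j' _ ⟨m, rfl⟩ _ ⟨n, rfl⟩
    refine CyclicOrthogonal.inner_zpow_zpow (hXo (ex _).2 (ex _).2 fun h => hkl ?_) m n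
    exact congrArg Prod.fst (ex.injective (Subtype.ext h))
  have hres : ∀ k, ∃ w : lp (fun _ : X => ℂ) 2 ≃ₗᵢ[ℂ] lp (fun _ : X => ℂ) 2,
      ∀ n, W (V k n) = V k (w n) := by
    intro k
    refine exists_restriction_of_range_invariant (V k) W (fun n => ?_) fun n => ?_
    · have h1 : V k n ∈ (D k).topologicalClosure := hVrange k ▸ ⟨n, rfl⟩
      have h2 := hDW k 1 _ h1
      rw [zpow_one] at h2
      rwa [hVrange]
    · have h1 : V k n ∈ (D k).topologicalClosure := hVrange k ▸ ⟨n, rfl⟩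
      have h2 := hDW k (-1) _ h1
      rw [zpow_neg_one] at h2
      rwa [hVrange]
  choose w hw using hres
  refine ⟨X, V, w, ?_, ?_, hw⟩
  · intro k l hkl n m
    have h1 : V k n ∈ (D k).topologicalClosure := hVrange k ▸ ⟨n, rfl⟩
    have h2 : V l m ∈ (D l).topologicalClosure := hVrange l ▸ ⟨m, rfl⟩
    have h3 : (D k).topologicalClosure ≤ (D l).topologicalClosureᗮ := by
      rw [Submodule.orthogonal_closure]
      exact Submodule.topologicalClosure_minimal _ (hDo k l hkl) (Submodule.isClosed_orthogonal _)
    exact Submodule.inner_left_of_mem_orthogonal h2 (h3 h1)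
  · rw [top_le_iff, Submodule.topologicalClosure_eq_top_iff, Submodule.eq_bot_iff]
    intro y hy
    refine hXtot y fun x hx n => ?_
    obtain ⟨⟨k, j⟩, hkj⟩ := ex.surjective ⟨x, hx⟩
    refine Submodule.inner_right_of_mem_orthogonal (K := ⨆ k, LinearMap.range (V k).toLinearMap)
      (Submodule.mem_iSup_of_mem k ?_) hy
    rw [hVrange]
    refine Submodule.le_topologicalClosure _ (Submodule.mem_iSup_of_mem j
      (Submodule.subset_span ⟨n, ?_⟩))
    simp [hkj]

/-- A unitary operator on a finite-dimensional space has an orthonormal basis of eigenvectors. -/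
theorem exists_orthonormalBasis_eigenvectors [FiniteDimensional ℂ M] (W : M ≃ₗᵢ[ℂ] M) :
    ∃ (n : ℕ) (b : OrthonormalBasis (Fin n) ℂ M) (c : Fin n → ℂ), ∀ i, W (b i) = c i • b i := by
  classical
  let T : Module.End ℂ M := ((W : M →L[ℂ] M) : M →ₗ[ℂ] M)
  have hfin : (spectrum ℂ (W : M →L[ℂ] M)).Finite := by
    have h := AlgEquiv.spectrum_eq (Module.End.toContinuousLinearMap (𝕜 := ℂ) M) T
    have h1 : Module.End.toContinuousLinearMap (𝕜 := ℂ) M T = (W : M →L[ℂ] M) := rfl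
    rw [← h1, h]
    exact Module.End.finite_spectrum T
  have htop := iSup_eigenspace_eq_top_of_finite_spectrum W hfin
  have : Finite (spectrum ℂ (W : M →L[ℂ] M)) := hfin.to_subtype
  have : Fintype (spectrum ℂ (W : M →L[ℂ] M)) := Fintype.ofFinite _
  let E : spectrum ℂ (W : M →L[ℂ] M) → Submodule ℂ M := fun c => Module.End.eigenspace T (c : ℂ)
  have hEW : ∀ c (x : E c), W x = (c : ℂ) • (x : M) := fun c x =>
    Module.End.mem_eigenspace_iff.1 x.2
  have hE : OrthogonalFamily ℂ (fun c => E c) fun c => (E c).subtypeₗᵢ := by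
    intro c d hcd x y
    change ⟪(x : M), (y : M)⟫_ℂ = 0
    -- From ⟪x, y⟫ = ⟪W x, W y⟫ = c̄ d ⟪x, y⟫ and |c| = 1 it follows that c = d.
    by_contra hxy
    have h1 := W.inner_map_map (x : M) y
    rw [hEW, hEW, inner_smul_left, inner_smul_right, ← mul_assoc] at h1
    have h2 := mul_right_cancel₀ hxy (h1.trans (one_mul _).symm)
    have hx0 : (x : M) ≠ 0 := fun h => hxy (by rw [h, inner_zero_left])
    have h3 : ‖(c : ℂ)‖ = 1 := by
      have h4 := W.norm_map (x : M)
      rw [hEW, norm_smul] at h4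
      exact mul_right_cancel₀ (norm_ne_zero_iff.2 hx0) (h4.trans (one_mul _).symm)
    have h5 : starRingEnd ℂ (c : ℂ) * c = 1 := by
      rw [Complex.conj_mul', h3]; simp
    have h6 : starRingEnd ℂ (c : ℂ) ≠ 0 := left_ne_zero_of_mul_eq_one h5
    exact hcd (Subtype.ext (mul_left_cancel₀ h6 (h5.trans h2.symm)))
  have hint : DirectSum.IsInternal E := by
    rw [hE.isInternal_iff]
    change (⨆ c : spectrum ℂ (W : M →L[ℂ] M), Module.End.eigenspace T (c : ℂ))ᗮ = ⊥
    rw [htop, Submodule.top_orthogonal_eq_bot]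
  refine ⟨_, hint.subordinateOrthonormalBasis rfl hE,
    fun i => (hint.subordinateOrthonormalBasisIndex rfl i hE).1, fun i => ?_⟩
  exact Module.End.mem_eigenspace_iff.1 (hint.subordinateOrthonormalBasis_subordinate rfl i hE)

/-- The index set is all of `ℕ`, so there is no last entry and no condition on the alternating
product. -/
theorem exists_four_symmetries_of_infinite (W : M ≃ₗᵢ[ℂ] M) (hM : ¬ FiniteDimensional ℂ M) :
    ∃ s₁ s₂ s₃ s₄ : M ≃ₗᵢ[ℂ] M, s₁ * s₁ = 1 ∧ s₂ * s₂ = 1 ∧ s₃ * s₃ = 1 ∧ s₄ * s₄ = 1 ∧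
      W = s₁ * s₂ * s₃ * s₄ := by
  obtain ⟨X, V, w, hVo, hVt, hw⟩ := exists_isHilbertSum_diagonal W hM
  have hV : IsHilbertSum ℂ (fun _ : {_k : ℕ // True} => lp (fun _ : X => ℂ) 2)
      (fun k => V k.1) := by
    refine IsHilbertSum.mk (fun k l hkl => hVo fun h => hkl (Subtype.ext h)) (hVt.trans ?_)
    refine Submodule.topologicalClosure_mono (iSup_le fun k => ?_)
    exact le_iSup (fun k : {_k : ℕ // True} => LinearMap.range (V k.1).toLinearMap) ⟨k, trivial⟩
  exact IsHilbertSum.exists_four_symmetries hV (fun _ _ => trivial) w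
    (fun _ _ h => absurd trivial h) W fun k n => hw k n

/-- In an eigenbasis the summands are copies of `ℂ`, whose unitaries commute. The alternating
product of all entries is therefore the determinant, and it must square to one. -/
theorem exists_four_symmetries_of_finite [FiniteDimensional ℂ M] (W : M ≃ₗᵢ[ℂ] M)
    (hdet : LinearMap.det (W.toLinearEquiv : M →ₗ[ℂ] M) ^ 2 = 1) :
    ∃ s₁ s₂ s₃ s₄ : M ≃ₗᵢ[ℂ] M, s₁ * s₁ = 1 ∧ s₂ * s₂ = 1 ∧ s₃ * s₃ = 1 ∧ s₄ * s₄ = 1 ∧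
      W = s₁ * s₂ * s₃ * s₄ := by
  obtain ⟨n, b, c, hc⟩ := exists_orthonormalBasis_eigenvectors W
  have hdetc : LinearMap.det (W.toLinearEquiv : M →ₗ[ℂ] M) = ∏ i, c i := by
    rw [← LinearMap.det_toMatrix b.toBasis, ← Matrix.det_diagonal]
    congr 1
    ext i j
    rw [LinearMap.toMatrix_apply, Matrix.diagonal_apply]
    have h1 : (W.toLinearEquiv : M →ₗ[ℂ] M) (b.toBasis j) = c j • b.toBasis j := by
      simpa using hc j
    rw [h1, map_smul, Finsupp.smul_apply, Module.Basis.repr_self, Finsupp.single_apply]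
    by_cases h : i = j
    · subst h; simp
    · simp [h, Ne.symm h]
  let β : {k // k < n} → M := fun k => b (Fin.equivSubtype.symm k)
  have hβ : Orthonormal ℂ β := b.orthonormal.comp _ Fin.equivSubtype.symm.injective
  have hspan : ⊤ ≤ (Submodule.span ℂ (Set.range β)).topologicalClosure := by
    refine le_trans ?_ (Submodule.le_topologicalClosure _)
    have : Set.range β = Set.range b := Fin.equivSubtype.symm.surjective.range_comp b
    rw [this, ← b.coe_toBasis, b.toBasis.span_eq]
  have hV := hβ.isHilbertSum hspan
  have hWβ : ∀ k, W (β k) = c (Fin.equivSubtype.symm k) • β k := fun k => hc _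
  have hWβ' : ∀ k, ∃ d : ℂ, W.symm (β k) = d • β k := by
    intro k
    have := zpow_apply_of_apply_eq_smul (hWβ k) (-1)
    rwa [zpow_neg_one] at this
  have hex : ∀ k : {k // k < n}, ∃ w : ℂ ≃ₗᵢ[ℂ] ℂ, ∀ z : ℂ,
      W (z • β k) = (w z) • β k := by
    intro k
    refine exists_restriction_of_range_invariant
      (LinearIsometry.toSpanSingleton ℂ M (hβ.1 k)) W (fun z => ?_) fun z => ?_
    · refine ⟨z * c (Fin.equivSubtype.symm k), ?_⟩
      simp [hWβ, smul_smul]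
    · obtain ⟨d, hd⟩ := hWβ' k
      refine ⟨z * d, ?_⟩
      simp [hd, smul_smul]
  choose w hw using hex
  have hwc : ∀ k z, w k z = c (Fin.equivSubtype.symm k) * z := by
    intro k z
    have h1 := hw k z
    rw [map_smul, hWβ, smul_smul] at h1
    have h2 := smul_left_injective ℂ (hβ.ne_zero k) h1
    rw [← h2, mul_comm]
  let w' : ℕ → ℂ ≃ₗᵢ[ℂ] ℂ := fun k => if h : k < n then w ⟨k, h⟩ else 1
  let c' : ℕ → ℂ := fun k => if h : k < n then c ⟨k, h⟩ else 1
  have hwc' : ∀ k z, w' k z = c' k * z := by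
    intro k z
    by_cases h : k < n
    · simp only [w', c', h, dif_pos, hwc]
      rfl
    · simp [w', c', h]
  have halt : ∀ k z, altProd w' k z = (∏ j ∈ Finset.range (k + 1), c' j) * z := by
    intro k
    induction k with
    | zero => intro z; simp [altProd, hwc']
    | succ k ih =>
      intro z
      rw [altProd, Finset.prod_range_succ]
      split_ifs <;> simp only [isometryEquiv_mul_apply, hwc', ih] <;> ring
  refine IsHilbertSum.exists_four_symmetries hV (fun k h => by omega) w' (fun k hk hk' => ?_) W ?_
  · obtain rfl : n = k + 1 := by omega
    have hprod : ∏ j ∈ Finset.range (k + 1), c' j = ∏ i, c i := by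
      rw [Finset.prod_range]
      refine Finset.prod_congr rfl fun i _ => ?_
      exact dif_pos i.2
    ext
    rw [isometryEquiv_mul_apply, halt, halt, hprod, ← mul_assoc, ← sq, ← hdetc, hdet]
    simp
  · rintro ⟨k, hk⟩ z
    have := hw ⟨k, hk⟩ z
    simpa [w', hk] using this

/-- A unitary operator is a product of four symmetries, if its determinant does not prevent
this. -/
theorem exists_four_symmetries (W : M ≃ₗᵢ[ℂ] M)
    (hdet : FiniteDimensional ℂ M → LinearMap.det (W.toLinearEquiv : M →ₗ[ℂ] M) ^ 2 = 1) :
    ∃ s₁ s₂ s₃ s₄ : M ≃ₗᵢ[ℂ] M, s₁ * s₁ = 1 ∧ s₂ * s₂ = 1 ∧ s₃ * s₃ = 1 ∧ s₄ * s₄ = 1 ∧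
      W = s₁ * s₂ * s₃ * s₄ := by
  by_cases hM : FiniteDimensional ℂ M
  · exact exists_four_symmetries_of_finite W (hdet hM)
  · exact exists_four_symmetries_of_infinite W hM

end FourSymmetries

/-! ### The relations in terms of operators. -/

section Relations

variable {H : Type*} {K : Type*}
  [NormedAddCommGroup H] [InnerProductSpace ℂ H] [CompleteSpace H]
  [NormedAddCommGroup K] [InnerProductSpace ℂ K] [CompleteSpace K]

open ContinuousLinearMap (adjoint)

theorem tripleProd_apply (a b c : H →L[ℂ] K) (x : H) :
    tripleProd a b c x = (1 / 2 : ℂ) • (a (adjoint b (c x)) + c (adjoint b (a x))) := rfl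

theorem tripleProd_self_apply (a b : H →L[ℂ] K) (x : H) :
    tripleProd a b a x = a (adjoint b (a x)) := by
  rw [tripleProd_apply, ← two_smul ℂ, smul_smul]
  norm_num

theorem isTripotent_iff {e : H →L[ℂ] K} : IsTripotent e ↔ ∀ x, e (adjoint e (e x)) = e x := by
  simp only [IsTripotent, ContinuousLinearMap.ext_iff, tripleProd_self_apply]

theorem leH_iff {u e : H →L[ℂ] K} : LeH u e ↔ ∀ x, u x = e (adjoint u (e x)) := by
  simp only [LeH, ContinuousLinearMap.ext_iff, tripleProd_self_apply]

theorem IsTripotent.adjoint_apply {e : H →L[ℂ] K} (he : IsTripotent e) (x : K) :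
    adjoint e (e (adjoint e x)) = adjoint e x := by
  have h : e ∘L (adjoint e ∘L e) = e := by
    ext y
    exact isTripotent_iff.1 he y
  have h' := congrArg adjoint h
  rw [ContinuousLinearMap.adjoint_comp, ContinuousLinearMap.adjoint_comp,
    ContinuousLinearMap.adjoint_adjoint] at h'
  exact DFunLike.congr_fun h' x

theorem leTwo_iff {u e : H →L[ℂ] K} (he : IsTripotent e) :
    LeTwo u e ↔ (∀ x, e (adjoint e (u x)) = u x) ∧ ∀ x, u (adjoint e (e x)) = u x := by
  rw [isTripotent_iff] at he
  have hsum : LeTwo u e ↔ ∀ x, e (adjoint e (u x)) + u (adjoint e (e x)) = (2 : ℂ) • u x := by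
    simp only [LeTwo, peirceTwo, Set.mem_ofPred_eq, ContinuousLinearMap.ext_iff, tripleProd_apply]
    refine forall_congr' fun x => ⟨fun h => ?_, fun h => ?_⟩
    · rw [← h, smul_smul, h]; norm_num
    · rw [h, smul_smul]; norm_num
  rw [hsum]
  refine ⟨fun h => ?_, fun h x => by rw [h.1, h.2, two_smul]⟩
  -- With the projections P = e e* and Q = e* e, multiplying P u + u Q = 2 u by P on the left and by
  -- Q on the right gives P u = P u Q = u Q.
  have h1 : ∀ x, e (adjoint e (u x)) = u (adjoint e (e x)) := by
    intro x
    have h2 := congrArg (fun z => e (adjoint e z)) (h x)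
    have h3 := h (adjoint e (e x))
    simp only [map_add, map_smul, he] at h2 h3
    rw [two_smul, add_right_inj] at h2
    rw [two_smul, add_left_inj] at h3
    rw [← h2, h3]
  have h2 : ∀ x, e (adjoint e (u x)) = u x := by
    intro x
    have h3 := h x
    rw [← h1, ← two_smul ℂ] at h3
    exact smul_right_injective K (two_ne_zero (α := ℂ)) h3
  exact ⟨h2, fun x => by rw [← h1, h2]⟩

theorem LeTwo.trans {u v e : H →L[ℂ] K} (hv : IsTripotent v) (he : IsTripotent e)
    (huv : LeTwo u v) (hve : LeTwo v e) : LeTwo u e := by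
  rw [leTwo_iff hv] at huv
  rw [leTwo_iff he] at hve ⊢
  refine ⟨fun x => ?_, fun x => ?_⟩
  · rw [← huv.1 x, hve.1]
  · rw [← huv.2 (adjoint e (e x)), hve.2, huv.2]

theorem LeH.leTwo {u e : H →L[ℂ] K} (he : IsTripotent e) (h : LeH u e) : LeTwo u e := by
  rw [leH_iff] at h
  rw [leTwo_iff he]
  rw [isTripotent_iff] at he
  exact ⟨fun x => by rw [h, he], fun x => by rw [h, he, ← h]⟩

theorem LeHC.leTwo {u e : H →L[ℂ] K} (he : IsTripotent e) (h : LeHC u e) : LeTwo u e := by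
  obtain ⟨α, hα, h⟩ := h
  have hα0 : α ≠ 0 := norm_ne_zero_iff.1 (by rw [hα]; exact one_ne_zero)
  have h1 := (leTwo_iff he).1 (h.leTwo he)
  simp only [smul_apply, map_smul] at h1
  exact (leTwo_iff he).2 ⟨fun x => smul_right_injective K hα0 (h1.1 x),
    fun x => smul_right_injective K hα0 (h1.2 x)⟩

theorem LeH.leHC {u e : H →L[ℂ] K} (h : LeH u e) : LeHC u e :=
  ⟨1, norm_one, by rwa [one_smul]⟩

theorem LeHC.leHCT {u e : Tripotent H K} (h : LeHC u.1 e.1) : LeHCT u e :=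
  Relation.TransGen.single h

theorem LeHCT.trans {u v e : Tripotent H K} (h : LeHCT u v) (h' : LeHCT v e) : LeHCT u e :=
  Relation.TransGen.trans h h'

theorem LeHCT.leTwo {u e : Tripotent H K} (h : LeHCT u e) : LeTwo u.1 e.1 := by
  induction h with
  | single h => exact LeHC.leTwo (Subtype.prop _) h
  | tail _ h ih => exact ih.trans (Subtype.prop _) (Subtype.prop _) (h.leTwo (Subtype.prop _))

theorem LeHT.leTwo {u e : Tripotent H K} (h : LeHT u e) : LeTwo u.1 e.1 :=
  LeHCT.leTwo (Relation.TransGen.mono (fun _ _ h => LeH.leHC h) _ _ h)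

end Relations

/-! ### Transport of the relations from `B(M)` to `B(H, K)`. -/

section Corner

variable {H : Type*} {K : Type*} {M : Type*}
  [NormedAddCommGroup H] [InnerProductSpace ℂ H] [CompleteSpace H]
  [NormedAddCommGroup K] [InnerProductSpace ℂ K] [CompleteSpace K]
  [NormedAddCommGroup M] [InnerProductSpace ℂ M] [CompleteSpace M]

open ContinuousLinearMap (adjoint)

/-- The embedding of the operators on `M` into `B(H, K)` that is induced by isometries from `M` to
`H` and to `K`. -/
def corner (ι : M →ₗᵢ[ℂ] H) (κ : M →ₗᵢ[ℂ] K) (A : M →L[ℂ] M) : H →L[ℂ] K :=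
  κ.toContinuousLinearMap ∘L (A ∘L adjoint ι.toContinuousLinearMap)

theorem adjoint_apply_isometry (ι : M →ₗᵢ[ℂ] H) (x : M) :
    adjoint ι.toContinuousLinearMap (ι x) = x := by
  refine ext_inner_right ℂ fun y => ?_
  rw [ContinuousLinearMap.adjoint_inner_left]
  exact ι.inner_map_map x y

variable (ι : M →ₗᵢ[ℂ] H) (κ : M →ₗᵢ[ℂ] K)

omit [CompleteSpace K] in
theorem corner_apply (A : M →L[ℂ] M) (x : H) :
    corner ι κ A x = κ (A (adjoint ι.toContinuousLinearMap x)) := rfl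

theorem adjoint_corner_apply (A : M →L[ℂ] M) (x : K) :
    adjoint (corner ι κ A) x = ι (adjoint A (adjoint κ.toContinuousLinearMap x)) := by
  rw [corner, ContinuousLinearMap.adjoint_comp, ContinuousLinearMap.adjoint_comp,
    ContinuousLinearMap.adjoint_adjoint]
  rfl

/-- The inner factors cancel because ι* ι = 1 and κ* κ = 1. -/
theorem tripleProd_corner (A B C : M →L[ℂ] M) :
    tripleProd (corner ι κ A) (corner ι κ B) (corner ι κ C) = corner ι κ (tripleProd A B C) := by
  ext x
  simp only [tripleProd_apply, adjoint_corner_apply, corner_apply, adjoint_apply_isometry,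
    map_smul, map_add]

omit [CompleteSpace K] in
theorem smul_corner (α : ℂ) (A : M →L[ℂ] M) : α • corner ι κ A = corner ι κ (α • A) := by
  ext x
  simp [corner_apply]

omit [CompleteSpace K] in
theorem corner_injective : Function.Injective (corner ι κ) := by
  intro A B h
  ext x
  have h1 := DFunLike.congr_fun h (ι x)
  simp only [corner_apply, adjoint_apply_isometry] at h1
  exact κ.injective h1

theorem isTripotent_corner {A : M →L[ℂ] M} : IsTripotent (corner ι κ A) ↔ IsTripotent A := by
  rw [IsTripotent, tripleProd_corner, (corner_injective ι κ).eq_iff, IsTripotent]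

theorem leTwo_corner {A B : M →L[ℂ] M} :
    LeTwo (corner ι κ A) (corner ι κ B) ↔ LeTwo A B := by
  simp only [LeTwo, peirceTwo, Set.mem_ofPred_eq, tripleProd_corner,
    (corner_injective ι κ).eq_iff]

theorem leH_corner {A B : M →L[ℂ] M} : LeH (corner ι κ A) (corner ι κ B) ↔ LeH A B := by
  rw [LeH, tripleProd_corner, (corner_injective ι κ).eq_iff, LeH]

theorem leHC_corner {A B : M →L[ℂ] M} : LeHC (corner ι κ A) (corner ι κ B) ↔ LeHC A B := by
  simp only [LeHC, smul_corner, leH_corner]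

theorem leN_corner {A B : M →L[ℂ] M} : LeN (corner ι κ A) (corner ι κ B) ↔ LeN A B := by
  simp only [LeN, tripleProd_corner, (corner_injective ι κ).eq_iff, isTripotent_corner]

/-- The map `corner` on tripotents. -/
def cornerTripotent (A : Tripotent M M) : Tripotent H K :=
  ⟨corner ι κ A.1, (isTripotent_corner ι κ).2 A.2⟩

theorem LeHCT.corner {A B : Tripotent M M} (h : LeHCT A B) :
    LeHCT (cornerTripotent ι κ A) (cornerTripotent ι κ B) :=
  Relation.TransGen.lift (cornerTripotent ι κ) (fun _ _ h => (leHC_corner ι κ).2 h) _ _ h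

end Corner

/-! ### The Peirce-2 space as an operator algebra. -/

section ExistsCorner

variable {H : Type*} {K : Type*}
  [NormedAddCommGroup H] [InnerProductSpace ℂ H] [CompleteSpace H]
  [NormedAddCommGroup K] [InnerProductSpace ℂ K] [CompleteSpace K]

open ContinuousLinearMap (adjoint)

/-- The Peirce-2 space of a tripotent consists of the operators on a Hilbert space, the tripotent
being the identity. -/
theorem exists_corner {e : H →L[ℂ] K} (he : IsTripotent e) :
    ∃ (M : Submodule ℂ H) (_ : CompleteSpace M) (ι : M →ₗᵢ[ℂ] H) (κ : M →ₗᵢ[ℂ] K),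
      e = corner ι κ 1 ∧ ∀ u, LeTwo u e → ∃ W : M →L[ℂ] M, u = corner ι κ W := by
  have he' := isTripotent_iff.1 he
  let q : H →L[ℂ] H := adjoint e ∘L e
  have hq : ∀ x, q (q x) = q x := fun x => congrArg (adjoint e) (he' x)
  -- `M` is the initial space of `e`; `ι` is its inclusion and `κ` the restriction of `e`, so that
  -- `e = κ ι*` and `u = κ (κ* u ι) ι*`.
  let M : Submodule ℂ H := LinearMap.eqLocus (q : H →ₗ[ℂ] H) LinearMap.id
  have hM : ∀ x, x ∈ M ↔ q x = x := fun x => Iff.rfl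
  have hcl : IsClosed (M : Set H) := isClosed_eq q.continuous continuous_id
  have hMc : CompleteSpace M := hcl.completeSpace_coe
  let ι : M →ₗᵢ[ℂ] H := M.subtypeₗᵢ
  let κ : M →ₗᵢ[ℂ] K := ⟨(e : H →ₗ[ℂ] K) ∘ₗ M.subtype, fun x => by
    have h1 : inner ℂ (e (x : H)) (e (x : H)) = inner ℂ (x : H) (x : H) := by
      rw [← ContinuousLinearMap.adjoint_inner_left]
      exact congrArg (fun z => inner ℂ z (x : H)) ((hM x).1 x.2)
    have h2 : ‖e (x : H)‖ ^ 2 = ‖(x : H)‖ ^ 2 := by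
      have h3 := congrArg Complex.re h1
      rwa [← RCLike.re_eq_complex_re, inner_self_eq_norm_sq (𝕜 := ℂ),
        inner_self_eq_norm_sq (𝕜 := ℂ)] at h3
    exact (sq_eq_sq₀ (norm_nonneg _) (norm_nonneg _)).1 h2⟩
  have hι : ∀ x, ((adjoint ι.toContinuousLinearMap x : M) : H) = q x := by
    intro x
    have hmem : q x ∈ M := hq x
    suffices h : adjoint ι.toContinuousLinearMap x = ⟨q x, hmem⟩ from congrArg Subtype.val h
    refine ext_inner_right ℂ fun y => ?_
    rw [ContinuousLinearMap.adjoint_inner_left]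
    change inner ℂ x (y : H) = inner ℂ (adjoint e (e x)) (y : H)
    rw [ContinuousLinearMap.adjoint_inner_left, ← ContinuousLinearMap.adjoint_inner_right]
    exact congrArg (inner ℂ x) ((hM y).1 y.2).symm
  have hκ : ∀ y, ((adjoint κ.toContinuousLinearMap y : M) : H) = adjoint e y := by
    intro y
    have hmem : adjoint e y ∈ M := he.adjoint_apply y
    suffices h : adjoint κ.toContinuousLinearMap y = ⟨adjoint e y, hmem⟩ from
      congrArg Subtype.val h
    refine ext_inner_right ℂ fun z => ?_
    rw [ContinuousLinearMap.adjoint_inner_left]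
    change inner ℂ y (e z) = inner ℂ (adjoint e y) (z : H)
    rw [ContinuousLinearMap.adjoint_inner_left]
  refine ⟨M, hMc, ι, κ, ?_, fun u hu => ?_⟩
  · ext x
    rw [corner_apply]
    change e x = e (adjoint ι.toContinuousLinearMap x : M)
    rw [hι]
    exact (he' x).symm
  · rw [leTwo_iff he] at hu
    refine ⟨adjoint κ.toContinuousLinearMap ∘L (u ∘L ι.toContinuousLinearMap), ?_⟩
    ext x
    rw [corner_apply]
    change u x = e (adjoint κ.toContinuousLinearMap
      (u (adjoint ι.toContinuousLinearMap x : M)) : M)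
    rw [hκ, hι, hu.1]
    exact (hu.2 x).symm

end ExistsCorner

/-! ### Unitaries and partial isometries below the identity. -/

section Unitary

variable {M : Type*} [NormedAddCommGroup M] [InnerProductSpace ℂ M] [CompleteSpace M]

open ContinuousLinearMap (adjoint)

theorem exists_four_symmetries_of_unitary {W : M →L[ℂ] M} (hW : W ∈ unitary (M →L[ℂ] M))
    (hdet : FiniteDimensional ℂ M → LinearMap.det (W : M →ₗ[ℂ] M) ^ 2 = 1) :
    ∃ s : Fin 4 → M →L[ℂ] M, (∀ i, star (s i) = s i) ∧ (∀ i, s i * s i = 1) ∧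
      W = s 0 * s 1 * s 2 * s 3 := by
  let Φ : unitary (M →L[ℂ] M) ≃* (M ≃ₗᵢ[ℂ] M) := Unitary.linearIsometryEquiv
  have hΦ : ((Φ ⟨W, hW⟩).toLinearEquiv : M →ₗ[ℂ] M) = (W : M →ₗ[ℂ] M) := rfl
  obtain ⟨s₁, s₂, s₃, s₄, h₁, h₂, h₃, h₄, h⟩ := exists_four_symmetries (Φ ⟨W, hW⟩)
    (by rwa [hΦ])
  have key : ∀ s : M ≃ₗᵢ[ℂ] M, s * s = 1 →
      star (Φ.symm s : M →L[ℂ] M) = Φ.symm s ∧ (Φ.symm s : M →L[ℂ] M) * Φ.symm s = 1 := by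
    intro s hs
    have h1 : Φ.symm s * Φ.symm s = 1 := by rw [← map_mul, hs, map_one]
    refine ⟨?_, congrArg Subtype.val h1⟩
    have h2 : star (Φ.symm s) = Φ.symm s := by
      rw [Unitary.star_eq_inv]
      exact inv_eq_of_mul_eq_one_left h1
    exact congrArg Subtype.val h2
  refine ⟨![Φ.symm s₁, Φ.symm s₂, Φ.symm s₃, Φ.symm s₄], ?_, ?_, ?_⟩
  · intro i
    fin_cases i
    exacts [(key _ h₁).1, (key _ h₂).1, (key _ h₃).1, (key _ h₄).1]
  · intro i
    fin_cases i
    exacts [(key _ h₁).2, (key _ h₂).2, (key _ h₃).2, (key _ h₄).2]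
  · have h5 : (⟨W, hW⟩ : unitary (M →L[ℂ] M)) =
        Φ.symm s₁ * Φ.symm s₂ * Φ.symm s₃ * Φ.symm s₄ := by
      rw [← map_mul, ← map_mul, ← map_mul, ← h, MulEquiv.symm_apply_apply]
    exact congrArg Subtype.val h5

theorem norm_det_of_unitary [FiniteDimensional ℂ M] {W : M →L[ℂ] M}
    (hW : W ∈ unitary (M →L[ℂ] M)) : ‖LinearMap.det (W : M →ₗ[ℂ] M)‖ = 1 := by
  rw [← LinearMap.normDet_eq_norm_det]
  exact LinearIsometry.normDet_eq_one
    (Unitary.linearIsometryEquiv (⟨W, hW⟩ : unitary (M →L[ℂ] M))).toLinearIsometry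

/-- In finite dimension a unitary operator has a multiple of determinant one. -/
theorem exists_smul_det_eq_one [FiniteDimensional ℂ M] {W : M →L[ℂ] M}
    (hW : W ∈ unitary (M →L[ℂ] M)) :
    ∃ c : ℂ, ‖c‖ = 1 ∧ LinearMap.det ((c • W : M →L[ℂ] M) : M →ₗ[ℂ] M) = 1 := by
  have hnorm := norm_det_of_unitary hW
  have h0 : LinearMap.det (W : M →ₗ[ℂ] M) ≠ 0 := norm_ne_zero_iff.1 (by rw [hnorm]; norm_num)
  rcases Nat.eq_zero_or_pos (Module.finrank ℂ M) with hn | hn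
  · exact ⟨1, norm_one, LinearMap.det_eq_one_of_finrank_eq_zero hn _⟩
  · obtain ⟨c, hc⟩ := IsAlgClosed.exists_pow_nat_eq (LinearMap.det (W : M →ₗ[ℂ] M))⁻¹ hn
    refine ⟨c, ?_, ?_⟩
    · have h1 := congrArg norm hc
      rw [norm_pow, norm_inv, hnorm, inv_one] at h1
      exact (pow_eq_one_iff_of_nonneg (norm_nonneg c) hn.ne').1 h1
    · have h1 : ((c • W : M →L[ℂ] M) : M →ₗ[ℂ] M) = c • (W : M →ₗ[ℂ] M) := rfl
      rw [h1, LinearMap.det_smul, hc, inv_mul_cancel₀ h0]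

theorem tripleProd_eq_mul (a b c : M →L[ℂ] M) :
    tripleProd a b c = (1 / 2 : ℂ) • (a * star b * c + c * star b * a) := rfl

theorem isTripotent_iff_mul {e : M →L[ℂ] M} : IsTripotent e ↔ e * star e * e = e := by
  rw [isTripotent_iff, ContinuousLinearMap.ext_iff]
  rfl

theorem leH_iff_mul {u e : M →L[ℂ] M} : LeH u e ↔ u = e * star u * e := by
  rw [leH_iff, ContinuousLinearMap.ext_iff]
  rfl

theorem leTwo_iff_mul {u e : M →L[ℂ] M} (he : IsTripotent e) :
    LeTwo u e ↔ e * star e * u = u ∧ u * star e * e = u := by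
  rw [leTwo_iff he, ContinuousLinearMap.ext_iff, ContinuousLinearMap.ext_iff]
  rfl

theorem isTripotent_of_unitary {W : M →L[ℂ] M} (hW : W ∈ unitary (M →L[ℂ] M)) :
    IsTripotent W := by
  rw [isTripotent_iff_mul, Unitary.mul_star_self_of_mem hW, one_mul]

theorem isTripotent_one : IsTripotent (1 : M →L[ℂ] M) := isTripotent_of_unitary (one_mem _)

theorem mem_unitary_of_leTwo {W : M →L[ℂ] M} (hW : IsTripotent W) (h : LeTwo 1 W) :
    W ∈ unitary (M →L[ℂ] M) := by
  rw [leTwo_iff_mul hW] at h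
  simp only [mul_one, one_mul] at h
  exact Unitary.mem_iff.2 ⟨h.2, h.1⟩

theorem leH_mul_symmetry {A s : M →L[ℂ] M} (hA : A ∈ unitary (M →L[ℂ] M)) (hs : star s = s) :
    LeH (A * s) A := by
  rw [leH_iff_mul, star_mul, hs, ← mul_assoc, mul_assoc (A * s), Unitary.star_mul_self_of_mem hA,
    mul_one]

theorem leH_of_mul_symmetry {A s : M →L[ℂ] M} (hA : A ∈ unitary (M →L[ℂ] M))
    (hs' : s * s = 1) : LeH A (A * s) := by
  rw [leH_iff_mul, mul_assoc (A * s), ← mul_assoc (star A), Unitary.star_mul_self_of_mem hA,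
    one_mul, mul_assoc, hs', mul_one]

theorem symmetry_mem_unitary {s : M →L[ℂ] M} (hs : star s = s) (hs' : s * s = 1) :
    s ∈ unitary (M →L[ℂ] M) := Unitary.mem_iff.2 ⟨by rw [hs, hs'], by rw [hs, hs']⟩

/-- Every unitary operator lies below the identity. -/
theorem leHCT_one_of_unitary {W : M →L[ℂ] M} (hW : W ∈ unitary (M →L[ℂ] M)) :
    LeHCT (⟨W, isTripotent_of_unitary hW⟩ : Tripotent M M) ⟨1, isTripotent_one⟩ := by
  obtain ⟨c, hc, hdet⟩ : ∃ c : ℂ, ‖c‖ = 1 ∧ (FiniteDimensional ℂ M →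
      LinearMap.det ((c • W : M →L[ℂ] M) : M →ₗ[ℂ] M) ^ 2 = 1) := by
    by_cases hM : FiniteDimensional ℂ M
    · obtain ⟨c, hc, hdet⟩ := exists_smul_det_eq_one hW
      exact ⟨c, hc, fun _ => by rw [hdet, one_pow]⟩
    · exact ⟨1, norm_one, fun h => absurd h hM⟩
  have hcc : star c * c = 1 := by
    rw [Complex.star_def, Complex.conj_mul', hc]; simp
  have hcW : c • W ∈ unitary (M →L[ℂ] M) := by
    refine Unitary.mem_iff.2 ⟨?_, ?_⟩
    · rw [star_smul, smul_mul_smul_comm, hcc, Unitary.star_mul_self_of_mem hW, one_smul]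
    · rw [star_smul, smul_mul_smul_comm, mul_comm, hcc, Unitary.mul_star_self_of_mem hW, one_smul]
  obtain ⟨s, hs, hs', h⟩ := exists_four_symmetries_of_unitary hcW hdet
  have hu : ∀ i, s i ∈ unitary (M →L[ℂ] M) := fun i => symmetry_mem_unitary (hs i) (hs' i)
  have hu1 := mul_mem (hu 0) (hu 1)
  have hu2 := mul_mem hu1 (hu 2)
  have h0 := leH_mul_symmetry (one_mem (unitary (M →L[ℂ] M))) (hs 0)
  rw [one_mul] at h0
  -- The scalar `c` is spent in this one link; the remaining links are `≤_h`.
  have h3 : LeHC W (s 0 * s 1 * s 2) := ⟨c, hc, h ▸ leH_mul_symmetry hu2 (hs 3)⟩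
  let T : ∀ {A : M →L[ℂ] M}, A ∈ unitary (M →L[ℂ] M) → Tripotent M M :=
    fun {A} hA => ⟨A, isTripotent_of_unitary hA⟩
  have c3 : LeHCT (T hW) (T hu2) := LeHC.leHCT h3
  have c2 : LeHCT (T hu2) (T hu1) := LeHC.leHCT (leH_mul_symmetry hu1 (hs 2)).leHC
  have c1 : LeHCT (T hu1) (T (hu 0)) := LeHC.leHCT (leH_mul_symmetry (hu 0) (hs 1)).leHC
  have c0 : LeHCT (T (hu 0)) ⟨1, isTripotent_one⟩ := LeHC.leHCT h0.leHC
  exact ((c3.trans c2).trans c1).trans c0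

/-- If the mean of the final and the initial projection of a partial isometry is a tripotent, these
projections coincide. -/
theorem mul_star_eq_star_mul_of_isTripotent {W : M →L[ℂ] M} (hW : IsTripotent W)
    (h : IsTripotent (tripleProd W W 1)) : W * star W = star W * W := by
  rw [isTripotent_iff_mul] at hW h
  set p := W * star W with hp
  set q := star W * W with hq
  have hp2 : p * p = p := by rw [hp, ← mul_assoc, hW]
  have hq2 : q * q = q := by
    rw [hq, mul_assoc, ← mul_assoc W, hW]
  have hps : star p = p := by simp [hp]
  have hqs : star q = q := by simp [hq]
  set y := tripleProd W W 1 with hy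
  have hypq : y = (1 / 2 : ℂ) • (p + q) := by
    rw [hy, tripleProd_eq_mul, mul_one, one_mul]
  have hys : star y = y := by
    rw [hypq, star_smul, star_add, hps, hqs]
    simp
  rw [hys] at h
  have h2y : p + q = (2 : ℂ) • y := by
    rw [hypq, smul_smul]; norm_num
  set d := p - q with hd
  have hds : star d = d := by rw [hd, star_sub, hps, hqs]
  have hd2 : d * d = (4 : ℂ) • y - (4 : ℂ) • (y * y) := by
    have h1 : d * d = (2 : ℂ) • (p + q) - (p + q) * (p + q) := by
      have h2 : d * d = (p * p + q * q) + (p * p + q * q) - (p + q) * (p + q) := by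
        rw [hd]
        noncomm_ring
      rw [h2, hp2, hq2, two_smul]
    rw [h1, h2y, smul_smul, smul_mul_smul_comm]
    norm_num
  -- Since d² = 4(y − y²) and y³ = y, the range of d² lies in the eigenspace of y at −1. This is
  -- zero because y is the mean of two projections, hence positive.
  have hyd : y * (d * d) = -(d * d) := by
    rw [hd2, mul_sub, mul_smul_comm, mul_smul_comm, ← mul_assoc, h, neg_sub]
  have hdd : d * d = 0 := by
    ext x
    set z := (d * d) x with hz
    have h1 : y z = -z := DFunLike.congr_fun hyd x
    have h2 : (2 : ℂ) * inner ℂ (y z) z = inner ℂ (adjoint W z) (adjoint W z) +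
        inner ℂ (W z) (W z) := by
      have h3 : (2 : ℂ) • y z = W (adjoint W z) + adjoint W (W z) :=
        (DFunLike.congr_fun h2y z).symm
      have h4 : inner ℂ ((2 : ℂ) • y z) z = inner ℂ (W (adjoint W z) + adjoint W (W z)) z := by
        rw [h3]
      rw [inner_add_left, inner_smul_left, ContinuousLinearMap.adjoint_inner_left W z (W z),
        ← ContinuousLinearMap.adjoint_inner_right W (adjoint W z) z] at h4
      rw [← h4, map_ofNat]
    have hsq : ∀ v : M, inner ℂ v v = ((‖v‖ ^ 2 : ℝ) : ℂ) := fun v => by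
      rw [inner_self_eq_norm_sq_to_K]
      push_cast
      rfl
    rw [h1, inner_neg_left, hsq, hsq, hsq] at h2
    have h5 : 2 * -‖z‖ ^ 2 = ‖adjoint W z‖ ^ 2 + ‖W z‖ ^ 2 := by exact_mod_cast h2
    have h6 : ‖z‖ ^ 2 ≤ 0 := by nlinarith [sq_nonneg ‖adjoint W z‖, sq_nonneg ‖W z‖]
    have h7 : ‖z‖ = 0 := by nlinarith [norm_nonneg z]
    simpa using h7
  have hd0 : d = 0 := by
    rw [← CStarRing.star_mul_self_eq_zero_iff, hds, hdd]
  exact sub_eq_zero.1 hd0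

/-- In finite dimension a partial isometry extends to a unitary operator. -/
theorem exists_unitary_leH [FiniteDimensional ℂ M] {W : M →L[ℂ] M} (hW : IsTripotent W) :
    ∃ U ∈ unitary (M →L[ℂ] M), LeH W U := by
  have hW' := isTripotent_iff.1 hW
  let S : Submodule ℂ M := LinearMap.range ((star W * W : M →L[ℂ] M) : M →ₗ[ℂ] M)
  let L : S →ₗᵢ[ℂ] M := ⟨(W : M →ₗ[ℂ] M) ∘ₗ S.subtype, by
    rintro ⟨_, x, rfl⟩
    change ‖W (adjoint W (W x))‖ = ‖adjoint W (W x)‖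
    have h1 : inner ℂ (W (adjoint W (W x))) (W (adjoint W (W x))) =
        inner ℂ (adjoint W (W x)) (adjoint W (W x)) := by
      rw [← ContinuousLinearMap.adjoint_inner_left, hW']
    have h3 := congrArg Complex.re h1
    rw [← RCLike.re_eq_complex_re, inner_self_eq_norm_sq (𝕜 := ℂ),
        inner_self_eq_norm_sq (𝕜 := ℂ)] at h3
    exact (sq_eq_sq₀ (norm_nonneg _) (norm_nonneg _)).1 h3⟩
  let E : M ≃ₗᵢ[ℂ] M := L.extend.toLinearIsometryEquiv rfl
  let U : unitary (M →L[ℂ] M) := Unitary.linearIsometryEquiv.symm E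
  have hUW : (U : M →L[ℂ] M) * (star W * W) = W := by
    ext x
    have h1 : L.extend ((star W * W) x) = W ((star W * W) x) :=
      L.extend_apply ⟨(star W * W) x, x, rfl⟩
    exact h1.trans (hW' x)
  refine ⟨U, U.2, ?_⟩
  -- Taking adjoints in `U W* W = W` gives `W* = W* W U*`, hence `U W* U = U W* W = W`.
  have hWs : star W = star W * W * star (U : M →L[ℂ] M) := by
    conv_lhs => rw [← hUW]
    simp [mul_assoc]
  rw [leH_iff_mul, hWs, mul_assoc, mul_assoc, Unitary.star_mul_self_of_mem U.2, mul_one, hUW]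

end Unitary

/-! ### Equivalence under `∼_2` gives `≤_{hc,t}`. -/

section Comparison

variable {H : Type*} {K : Type*}
  [NormedAddCommGroup H] [InnerProductSpace ℂ H] [CompleteSpace H]
  [NormedAddCommGroup K] [InnerProductSpace ℂ K] [CompleteSpace K]

theorem exists_unitary_corner {M : Type*} [NormedAddCommGroup M] [InnerProductSpace ℂ M]
    [CompleteSpace M] {ι : M →ₗᵢ[ℂ] H} {κ : M →ₗᵢ[ℂ] K}
    (hc : ∀ u, LeTwo u (corner ι κ 1) → ∃ W : M →L[ℂ] M, u = corner ι κ W)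
    {u : H →L[ℂ] K} (hu : IsTripotent u) (h : LeTwo u (corner ι κ 1))
    (h' : LeTwo (corner ι κ 1) u) : ∃ W ∈ unitary (M →L[ℂ] M), u = corner ι κ W := by
  obtain ⟨W, rfl⟩ := hc u h
  exact ⟨W, mem_unitary_of_leTwo ((isTripotent_corner ι κ).1 hu) ((leTwo_corner ι κ).1 h'), rfl⟩

theorem leHCT_of_leTwo_of_leTwo {u e : Tripotent H K} (h : LeTwo u.1 e.1) (h' : LeTwo e.1 u.1) :
    LeHCT u e := by
  obtain ⟨M, _, ι, κ, he, hc⟩ := exists_corner e.2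
  rw [he] at h h' hc
  obtain ⟨W, hW, hu⟩ := exists_unitary_corner hc u.2 h h'
  have hue : u = cornerTripotent ι κ ⟨W, isTripotent_of_unitary hW⟩ := Subtype.ext hu
  have hee : e = cornerTripotent ι κ ⟨1, isTripotent_one⟩ := Subtype.ext he
  rw [hue, hee]
  exact (leHCT_one_of_unitary hW).corner ι κ

end Comparison

/-! ### Comparing `≤_n` and `≤_{hc}` below the identity. -/

section BelowIdentity

variable {M : Type*} [NormedAddCommGroup M] [InnerProductSpace ℂ M] [CompleteSpace M]

/-- The relation `≤_{hc}` implies `≤_n` below the identity. -/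
theorem isTripotent_tripleProd_one_of_leHC {W : M →L[ℂ] M} (hWt : IsTripotent W)
    (h : LeHC W 1) : IsTripotent (tripleProd W W 1) := by
  rw [isTripotent_iff_mul] at hWt
  obtain ⟨α, hα, h⟩ := h
  rw [leH_iff_mul, one_mul, mul_one, star_smul] at h
  have hαα : star α * α = 1 := by
    rw [Complex.star_def, Complex.conj_mul', hα]; simp
  -- `α W ≤_h 1` says that `α W` is self-adjoint. Hence `W` is normal and `{W, W, 1}` is the
  -- projection `W W*`.
  have hWs : star W = (α * α) • W := by
    rw [mul_smul, h, smul_smul, mul_comm, hαα, one_smul]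
  have hnormal : star W * W = W * star W := by
    rw [hWs, smul_mul_assoc, mul_smul_comm]
  have hprod : tripleProd W W 1 = W * star W := by
    rw [tripleProd_eq_mul, mul_one, one_mul, hnormal, ← two_smul ℂ, smul_smul]
    norm_num
  have hr2 : W * star W * (W * star W) = W * star W := by rw [← mul_assoc, hWt]
  rw [hprod, isTripotent_iff_mul, star_mul, star_star, hr2, hr2]

/-- The relation `≤_n` implies `≤_{hc,t}` below the identity. -/
theorem leHCT_one_of_isTripotent_tripleProd {W : M →L[ℂ] M} (hWt : IsTripotent W)
    (h : IsTripotent (tripleProd W W 1)) :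
    LeHCT (⟨W, hWt⟩ : Tripotent M M) ⟨1, isTripotent_one⟩ := by
  have hnormal := mul_star_eq_star_mul_of_isTripotent hWt h
  have hWt' := isTripotent_iff_mul.1 hWt
  have hr2 : W * star W * (W * star W) = W * star W := by rw [← mul_assoc, hWt']
  have hrs : star (W * star W) = W * star W := by rw [star_mul, star_star]
  have hrt : IsTripotent (W * star W) := by
    rw [isTripotent_iff_mul, hrs, hr2, hr2]
  let w : Tripotent M M := ⟨W, hWt⟩
  let r : Tripotent M M := ⟨W * star W, hrt⟩
  let i : Tripotent M M := ⟨1, isTripotent_one⟩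
  have h1 : LeHCT w r := by
    refine leHCT_of_leTwo_of_leTwo ((leTwo_iff_mul hrt).2 ?_) ((leTwo_iff_mul hWt).2 ?_)
    · change W * star W * star (W * star W) * W = W ∧
        W * star (W * star W) * (W * star W) = W
      rw [hrs, hr2, mul_assoc W (W * star W), hr2]
      refine ⟨hWt', ?_⟩
      rw [hnormal, ← mul_assoc, hWt']
    · refine ⟨hr2, ?_⟩
      rw [mul_assoc (W * star W), ← hnormal, hr2]
  have h2 : LeHCT r i := by
    refine LeHC.leHCT (LeH.leHC (leH_iff_mul.2 ?_))
    rw [one_mul, mul_one, hrs]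
  exact h1.trans h2

end BelowIdentity

/-! ### The three statements in `B(H, K)`. -/

section Comparison

variable {H : Type*} {K : Type*}
  [NormedAddCommGroup H] [InnerProductSpace ℂ H] [CompleteSpace H]
  [NormedAddCommGroup K] [InnerProductSpace ℂ K] [CompleteSpace K]

theorem leN_of_leHC {u e : Tripotent H K} (h : LeHC u.1 e.1) : LeN u.1 e.1 := by
  have h2 := h.leTwo e.2
  obtain ⟨M, _, ι, κ, he, hc⟩ := exists_corner e.2
  obtain ⟨W, hu⟩ := hc _ h2
  have hWt := u.2
  rw [hu, isTripotent_corner] at hWt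
  rw [he, hu, leTwo_corner] at h2
  rw [he, hu, leHC_corner] at h
  rw [he, hu, leN_corner]
  refine ⟨Eq.symm h2, ?_⟩
  exact isTripotent_tripleProd_one_of_leHC hWt h

theorem leHCT_of_leN {u e : Tripotent H K} (h : LeN u.1 e.1) : LeHCT u e := by
  obtain ⟨M, _, ι, κ, he, hc⟩ := exists_corner e.2
  obtain ⟨W, hu⟩ := hc _ h.1.symm
  have hWt := u.2
  rw [hu, isTripotent_corner] at hWt
  rw [he, hu, leN_corner] at h
  have hue : u = cornerTripotent ι κ ⟨W, hWt⟩ := Subtype.ext hu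
  have hee : e = cornerTripotent ι κ ⟨1, isTripotent_one⟩ := Subtype.ext he
  rw [hue, hee]
  exact (leHCT_one_of_isTripotent_tripleProd hWt h.2).corner ι κ

theorem leNT_iff_leHCT {u e : Tripotent H K} : LeNT u e ↔ LeHCT u e := by
  refine ⟨fun h => ?_, Relation.TransGen.mono (fun _ _ h => leN_of_leHC h) u e⟩
  induction h with
  | single h => exact leHCT_of_leN h
  | tail _ h ih => exact ih.trans (leHCT_of_leN h)

theorem simTwo_iff_simHCT {u e : Tripotent H K} : SimTwo u e ↔ SimHCT u e :=
  ⟨fun h => ⟨leHCT_of_leTwo_of_leTwo h.1 h.2, leHCT_of_leTwo_of_leTwo h.2 h.1⟩,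
    fun h => ⟨h.1.leTwo, h.2.leTwo⟩⟩

theorem leHCT_of_leTwo (hfin : FiniteDimensional ℂ H ∨ FiniteDimensional ℂ K)
    {u e : Tripotent H K} (h : LeTwo u.1 e.1) : LeHCT u e := by
  obtain ⟨M, _, ι, κ, he, hc⟩ := exists_corner e.2
  have hM : FiniteDimensional ℂ M := by
    rcases hfin with hH | hK
    · exact Module.Finite.of_injective ι.toLinearMap ι.injective
    · exact Module.Finite.of_injective κ.toLinearMap κ.injective
  obtain ⟨W, hu⟩ := hc _ h
  have hWt := u.2
  rw [hu, isTripotent_corner] at hWt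
  obtain ⟨U, hU, hWU⟩ := exists_unitary_leH hWt
  have hue : u = cornerTripotent ι κ ⟨W, hWt⟩ := Subtype.ext hu
  have hee : e = cornerTripotent ι κ ⟨1, isTripotent_one⟩ := Subtype.ext he
  rw [hue, hee]
  have h1 : LeHCT (⟨W, hWt⟩ : Tripotent M M) ⟨U, isTripotent_of_unitary hU⟩ :=
    LeHC.leHCT hWU.leHC
  exact (h1.trans (leHCT_one_of_unitary hU)).corner ι κ

/-- On unitary operators, `≤_h` preserves the square of the determinant. -/
theorem LeH.det_sq_eq {M : Type*} [NormedAddCommGroup M] [InnerProductSpace ℂ M]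
    [CompleteSpace M] {A B : M →L[ℂ] M} (hA : A ∈ unitary (M →L[ℂ] M)) (h : LeH A B) :
    LinearMap.det (A : M →ₗ[ℂ] M) ^ 2 = LinearMap.det (B : M →ₗ[ℂ] M) ^ 2 := by
  have hmul : ∀ S T : M →L[ℂ] M, LinearMap.det ((S * T : M →L[ℂ] M) : M →ₗ[ℂ] M) =
      LinearMap.det (S : M →ₗ[ℂ] M) * LinearMap.det (T : M →ₗ[ℂ] M) :=
    fun S T => LinearMap.det_comp (S : M →ₗ[ℂ] M) T
  have h1 := hmul A (star A)
  rw [Unitary.mul_star_self_of_mem hA] at h1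
  have h2 : LinearMap.det ((1 : M →L[ℂ] M) : M →ₗ[ℂ] M) = 1 := LinearMap.det_id
  rw [h2] at h1
  have h3 := congrArg (fun T : M →L[ℂ] M => LinearMap.det (T : M →ₗ[ℂ] M)) (leH_iff_mul.1 h)
  simp only [hmul] at h3
  -- Here det A = (det B)² det A* and det A · det A* = 1. In infinite dimension `LinearMap.det` is 1
  -- by convention, so no dimension hypothesis is needed.
  linear_combination (LinearMap.det (A : M →ₗ[ℂ] M)) * h3 -
    LinearMap.det (B : M →ₗ[ℂ] M) ^ 2 * h1

/-- Every member of a `≤_h` chain from `u` to `e` lies `≤_2`-between them. If also `e ≤_2 u`, all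
members come from unitaries of `M`, and the squared determinant stays constant along the chain, up
to its value 1 at `e`. -/
theorem LeHT.exists_unitary_det_sq_eq_one {M : Type*} [NormedAddCommGroup M]
    [InnerProductSpace ℂ M] [CompleteSpace M] {ι : M →ₗᵢ[ℂ] H} {κ : M →ₗᵢ[ℂ] K}
    {u e : Tripotent H K} (he : e.1 = corner ι κ 1)
    (hc : ∀ u, LeTwo u e.1 → ∃ W : M →L[ℂ] M, u = corner ι κ W)
    (h : LeHT u e) (h' : LeTwo e.1 u.1) :
    ∃ W ∈ unitary (M →L[ℂ] M), u.1 = corner ι κ W ∧ LinearMap.det (W : M →ₗ[ℂ] M) ^ 2 = 1 := by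
  have hc' := hc
  rw [he] at hc'
  have hstep : ∀ {x : Tripotent H K}, LeHT x e → LeTwo e.1 x.1 →
      ∃ W ∈ unitary (M →L[ℂ] M), x.1 = corner ι κ W := by
    intro x hx hx'
    have hx2 := hx.leTwo
    rw [he] at hx2 hx'
    exact exists_unitary_corner hc' x.2 hx2 hx'
  induction h using Relation.TransGen.head_induction_on with
  | @single x hx =>
    obtain ⟨W, hW, hWx⟩ := hstep (Relation.TransGen.single hx) h'
    refine ⟨W, hW, hWx, ?_⟩
    rw [hWx, he, leH_corner] at hx
    rw [hx.det_sq_eq hW]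
    have h2 : LinearMap.det ((1 : M →L[ℂ] M) : M →ₗ[ℂ] M) = 1 := LinearMap.det_id
    rw [h2, one_pow]
  | @head x y hxy hy ih =>
    obtain ⟨W, hW, hWx⟩ := hstep (Relation.TransGen.head hxy hy) h'
    obtain ⟨Y, hY, hYy, hdet⟩ := ih (h'.trans x.2 y.2 (hxy.leTwo y.2))
    refine ⟨W, hW, hWx, ?_⟩
    rw [hWx, hYy, leH_corner] at hxy
    rw [hxy.det_sq_eq hW, hdet]

/-- The three intermediate tripotents are the proper partial products of the four symmetries. -/
theorem SimHT.exists_simH_chain {u v : Tripotent H K} (h : SimHT u v) :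
    ∃ v₁ v₂ v₃ : Tripotent H K, SimH u v₃ ∧ SimH v₃ v₂ ∧ SimH v₂ v₁ ∧ SimH v₁ v := by
  obtain ⟨M, _, ι, κ, he, hc⟩ := exists_corner v.2
  obtain ⟨W, hW, hu, hdet⟩ := h.1.exists_unitary_det_sq_eq_one he hc h.2.leTwo
  obtain ⟨s, hs, hs', hWs⟩ := exists_four_symmetries_of_unitary hW fun _ => hdet
  have hmem : ∀ i, s i ∈ unitary (M →L[ℂ] M) := fun i => symmetry_mem_unitary (hs i) (hs' i)
  let T : ∀ {A : M →L[ℂ] M}, A ∈ unitary (M →L[ℂ] M) → Tripotent H K :=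
    fun {A} hA => cornerTripotent ι κ ⟨A, isTripotent_of_unitary hA⟩
  have hT : ∀ {A : M →L[ℂ] M} (hA : A ∈ unitary (M →L[ℂ] M)) (i : Fin 4),
      SimH (T (mul_mem hA (hmem i))) (T hA) := fun hA i =>
    ⟨(leH_corner ι κ).2 (leH_mul_symmetry hA (hs i)),
      (leH_corner ι κ).2 (leH_of_mul_symmetry hA (hs' i))⟩
  have hv : v = T (one_mem _) := Subtype.ext he
  have h0 : 1 * s 0 ∈ unitary (M →L[ℂ] M) := mul_mem (one_mem _) (hmem 0)
  have h1 := mul_mem h0 (hmem 1)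
  have h2 := mul_mem h1 (hmem 2)
  have hu' : u = T (mul_mem h2 (hmem 3)) := by
    refine Subtype.ext (hu.trans (congrArg (corner ι κ) ?_))
    change W = 1 * s 0 * s 1 * s 2 * s 3
    rw [hWs, one_mul]
  rw [hu', hv]
  exact ⟨T h0, T h1, T h2, hT h2 3, hT h1 2, hT h0 1, hT (one_mem _) 0⟩

end Comparison

end TripotentOrder

end

theorem propositionP {H : Type*} {K : Type*}
    [NormedAddCommGroup H] [InnerProductSpace ℂ H] [CompleteSpace H]
    [NormedAddCommGroup K] [InnerProductSpace ℂ K] [CompleteSpace K] :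
    ((∀ u e : TripotentOrder.Tripotent H K,
        TripotentOrder.LeNT u e ↔ TripotentOrder.LeHCT u e) ∧
      (∀ u e : TripotentOrder.Tripotent H K,
        TripotentOrder.SimTwo u e ↔ TripotentOrder.SimHCT u e)) ∧
    ((FiniteDimensional ℂ H ∨ FiniteDimensional ℂ K) →
      ∀ u e : TripotentOrder.Tripotent H K,
        (TripotentOrder.LeTwo u.1 e.1 ↔ TripotentOrder.LeNT u e) ∧
        (TripotentOrder.LeNT u e ↔ TripotentOrder.LeHCT u e)) ∧
    (∀ u v : TripotentOrder.Tripotent H K, TripotentOrder.SimHT u v →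
      ∃ v₁ v₂ v₃ : TripotentOrder.Tripotent H K,
        TripotentOrder.SimH u v₃ ∧ TripotentOrder.SimH v₃ v₂ ∧
        TripotentOrder.SimH v₂ v₁ ∧ TripotentOrder.SimH v₁ v) := by
  refine ⟨⟨fun _ _ => TripotentOrder.leNT_iff_leHCT, fun _ _ => TripotentOrder.simTwo_iff_simHCT⟩,
    fun hfin _ _ => ⟨⟨fun h => ?_, fun h => ?_⟩, TripotentOrder.leNT_iff_leHCT⟩,
    fun _ _ h => h.exists_simH_chain⟩
  · exact TripotentOrder.leNT_iff_leHCT.2 (TripotentOrder.leHCT_of_leTwo hfin h)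
  · exact (TripotentOrder.leNT_iff_leHCT.1 h).leTwo
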